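/- Let $t\in\mathbb R\setminus\{0,1,-1\}$ and put $[n]=\frac{t^{2n}-t^{-2n}}{t^2-t^{-2}}$, $[n]!=[1][2]\cdots[n]$. Let $U_t=U_t(su(2))$ be the complex Hopf algebra generated by $e,f,k^{\pm1}$ with relations $kk^{-1}=k^{-1}k=1$, $ke=t^2ek$, $kf=t^{-2}fk$, $[e,f]=\frac{k^2-k^{-2}}{t^2-t^{-2}}$, coproduct $\Delta(k^{\pm1})=k^{\pm1}\otimes k^{\pm1}$, $\Delta(e)=e\otimes k^{-1}+k\otimes e$, $\Delta(f)=f\otimes k^{-1}+k\otimes f$, counit $\varepsilon(k^{\pm1})=1$, $\varepsilon(e)=\varepsilon(f)=0$ and antipode $S(k^{\pm1})=k^{\mp1}$, $S(e)=-t^{-2}e$, $S(f)=-t^2f$. Let $\mathrm{ad}_a(b)=\sum a_{(1)}bS(a_{(2)})$ be its adjoint representation, and for $j\in\frac12\mathbb Z_{\ge0}$ let $(V^j,\pi^j)$ be the $(2j+1)$-dimensional representation with weight basis $e_m$, $m=j,j-1,\dots,-j$, and $$\pi^j(e)e_m=([j-m][j+m+1])^{1/2}e_{m+1},\quad \pi^j(f)e_m=([j+m][j-m+1])^{1/2}e_{m-1},\quad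 \pi^j(k^{\pm1})e_m=t^{\pm2m}e_m .$$ For a natural number $l\ge 0$ and $p=l,l-1,\dots,-l$ let $$\lambda^l_p=\left(\frac{[l+p]!}{[2l]!\,[l-p]!}\right)^{1/2}(\mathrm{ad}_f)^{\,l-p}(e^lk^{-l})\in U_t,$$ and let $U^l\subset U_t$ be the linear span of these elements. Let $(lp,jn\mid jm)_t$ be the Clebsch–Gordan coefficients of the component $V^j$ of $V^l\otimes V^j$: the real numbers such that the $V^j$-part of $e_p\otimes e_n$ is $\sum_m (lp,jn\mid jm)_t\,e^j_m$, where the $e^j_m=\sum_{p,n}(lp,jn\mid jm)_t\,e_p\otimes e_n$ form an orthonormal weight basis of that component (transforming as the $e_m$ above), with the phase fixed by requiring $(ll,j\,(j-l)\mid jj)_t$ to have the sign of $t^{l(l+1)-2(j+1)l}$ (positive for $t>0$); they are $0$ if $V^j$ does not occur, i.e. if $l>2j$. Then $\lambda^l_l,\dots,\lambda^l_{-l}$ are linearly independent, $U^l$ is an irreducible subrepresentation of the adjoint representation, $V^j$ is irreducible, and $\pi^j:U^l\to \mathrm{Hom}(V^j,V^j)$ is an irreducible tensor operator, i.e. $\pi^j(\mathrm{ad}_a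 u)=\sum\pi^j(a_{(1)})\circ\pi^j(u)\circ\pi^j(S(a_{(2)}))$ for all $a\in U_t$, $u\in U^l$. If $l\le 2j$, then for all $p,m,n$ $$\pi^j(\lambda^l_p)_{mn}=\alpha\,(lp,jn\mid jm)_t,\qquad \alpha=t^{l(l+1)}\,[l]!\left(\frac{[2j+l+1]!}{[2l]!\,[2j-l]!\,[2j+1]}\right)^{1/2}.$$ If $l>2j$, then $\pi^j(\lambda^l_p)_{mn}=0=(lp,jn\mid jm)_t$ for all $p,m,n$. -/

import Mathlib

open scoped TensorProduct

noncomputable section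

/-! ## Representations of a Hopf algebra -/

namespace HopfRep

variable {A V W : Type*} [Ring A] [HopfAlgebra ℂ A]
  [AddCommGroup V] [Module ℂ V] [AddCommGroup W] [Module ℂ W]

/-- The adjoint representation of a Hopf algebra on itself: `ad_a (b) = ∑ a₍₁₎ b S(a₍₂₎)`. -/
def ad (A : Type*) [Ring A] [HopfAlgebra ℂ A] : A →ₐ[ℂ] Module.End ℂ A :=
  (Algebra.TensorProduct.lift (Algebra.lmul ℂ A)
    (AlgHom.ofLinearMap ((LinearMap.mul ℂ A).flip ∘ₗ HopfAlgebra.antipode ℂ)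
      (by ext x; simp)
      (fun a b => by
        ext x; simp [HopfAlgebra.antipode_mul_antidistrib, mul_assoc]))
    (fun a b => by
      ext x; simp [mul_assoc])).comp (Bialgebra.comulAlgHom ℂ A)

/-- The representation of a Hopf algebra on `Hom(V, W)`, for representations `π` on `V` and `ρ`
on `W`: `δ(a) f = ∑ ρ(a₍₁₎) ∘ f ∘ π(S(a₍₂₎))`. -/
def homRep (π : A →ₐ[ℂ] Module.End ℂ V) (ρ : A →ₐ[ℂ] Module.End ℂ W) :
    A →ₐ[ℂ] Module.End ℂ (V →ₗ[ℂ] W) :=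
  (Algebra.TensorProduct.lift
    (AlgHom.ofLinearMap (LinearMap.llcomp ℂ V W W ∘ₗ ρ.toLinearMap)
      (by ext f x; simp)
      (fun a b => by ext f x; simp))
    (AlgHom.ofLinearMap
      ((LinearMap.llcomp ℂ V V W).flip ∘ₗ π.toLinearMap ∘ₗ HopfAlgebra.antipode ℂ)
      (by ext f x; simp)
      (fun a b => by ext f x; simp [HopfAlgebra.antipode_mul_antidistrib]))
    (fun a b => by ext f x; simp)).comp (Bialgebra.comulAlgHom ℂ A)

/-- The tensor product of two representations: `a (v ⊗ w) = ∑ a₍₁₎ v ⊗ a₍₂₎ w`. -/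
def tensorRep (π : A →ₐ[ℂ] Module.End ℂ V) (ρ : A →ₐ[ℂ] Module.End ℂ W) :
    A →ₐ[ℂ] Module.End ℂ (V ⊗[ℂ] W) :=
  (Module.endTensorEndAlgHom (R := ℂ) (S := ℂ) (A := ℂ)).comp
    ((Algebra.TensorProduct.map π ρ).comp (Bialgebra.comulAlgHom ℂ A))

/-- The subspace `S` is a nonzero invariant subspace of the representation `σ` and `σ` is
irreducible on it. -/
structure IsIrreducibleOn (σ : A →ₐ[ℂ] Module.End ℂ V) (S : Submodule ℂ V) : Prop where
  ne_bot : S ≠ ⊥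
  invariant : ∀ a, ∀ x ∈ S, σ a x ∈ S
  eq_bot_or_eq : ∀ S' ≤ S, (∀ a, ∀ x ∈ S', σ a x ∈ S') → S' = ⊥ ∨ S' = S

/-- `T : S → Hom(W₁, W₂)` is an irreducible tensor operator, `S` being a subrepresentation of `σ`:
the three representations are irreducible and `T` is a homomorphism of representations. -/
structure IsIrreducibleTensorOperator {W₁ W₂ : Type*} [AddCommGroup W₁] [Module ℂ W₁]
    [AddCommGroup W₂] [Module ℂ W₂]
    (σ : A →ₐ[ℂ] Module.End ℂ V) (S : Submodule ℂ V)
    (ρ₁ : A →ₐ[ℂ] Module.End ℂ W₁) (ρ₂ : A →ₐ[ℂ] Module.End ℂ W₂)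
    (T : S →ₗ[ℂ] (W₁ →ₗ[ℂ] W₂)) : Prop where
  irreducible_type : IsIrreducibleOn σ S
  irreducible_source : IsIrreducibleOn ρ₁ ⊤
  irreducible_target : IsIrreducibleOn ρ₂ ⊤
  equivariant : ∀ (a : A) (x y : S), (y : V) = σ a x → T y = homRep ρ₁ ρ₂ a (T x)

end HopfRep

/-! ## The quantum algebra `U_t(su(2))`, `t` real and nonzero -/

namespace QuantumSU2

/-- The generators `e`, `f`, `k`, `k⁻¹`. -/
inductive Gen
  | e
  | f
  | k
  | kinv

/-- The defining relations. -/
inductive Rel (t : ℝˣ) : FreeAlgebra ℂ Gen → FreeAlgebra ℂ Gen → Prop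
  | k_kinv : Rel t (FreeAlgebra.ι ℂ Gen.k * FreeAlgebra.ι ℂ Gen.kinv) 1
  | kinv_k : Rel t (FreeAlgebra.ι ℂ Gen.kinv * FreeAlgebra.ι ℂ Gen.k) 1
  | k_e : Rel t (FreeAlgebra.ι ℂ Gen.k * FreeAlgebra.ι ℂ Gen.e)
      (((t : ℝ) : ℂ) ^ (2 : ℤ) • (FreeAlgebra.ι ℂ Gen.e * FreeAlgebra.ι ℂ Gen.k))
  | k_f : Rel t (FreeAlgebra.ι ℂ Gen.k * FreeAlgebra.ι ℂ Gen.f)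
      (((t : ℝ) : ℂ) ^ (-2 : ℤ) • (FreeAlgebra.ι ℂ Gen.f * FreeAlgebra.ι ℂ Gen.k))
  | e_f : Rel t (FreeAlgebra.ι ℂ Gen.e * FreeAlgebra.ι ℂ Gen.f
        - FreeAlgebra.ι ℂ Gen.f * FreeAlgebra.ι ℂ Gen.e)
      ((((t : ℝ) : ℂ) ^ (2 : ℤ) - ((t : ℝ) : ℂ) ^ (-2 : ℤ))⁻¹ •
        (FreeAlgebra.ι ℂ Gen.k ^ 2 - FreeAlgebra.ι ℂ Gen.kinv ^ 2))

/-- The algebra `U_t(su(2))`, that is the complex algebra `U_t(sl(2))` for real `t`. -/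
def U (t : ℝˣ) : Type := RingQuot (Rel t)

instance instRing (t : ℝˣ) : Ring (U t) := inferInstanceAs (Ring (RingQuot (Rel t)))

instance instAlgebra (t : ℝˣ) : Algebra ℂ (U t) := inferInstanceAs (Algebra ℂ (RingQuot (Rel t)))

/-- The quotient map from the free algebra. -/
def mk (t : ℝˣ) : FreeAlgebra ℂ Gen →ₐ[ℂ] U t := RingQuot.mkAlgHom ℂ (Rel t)

lemma mk_rel {t : ℝˣ} {x y : FreeAlgebra ℂ Gen} (h : Rel t x y) : mk t x = mk t y :=
  RingQuot.mkAlgHom_rel ℂ h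

variable {t : ℝˣ}

/-- The image of a generator in `U t`. -/
def gen (t : ℝˣ) (g : Gen) : U t := mk t (FreeAlgebra.ι ℂ g)

/-- The generator `e`. -/
def e (t : ℝˣ) : U t := gen t Gen.e
/-- The generator `f`. -/
def f (t : ℝˣ) : U t := gen t Gen.f
/-- The generator `k`. -/
def k (t : ℝˣ) : U t := gen t Gen.k
/-- The generator `k⁻¹`. -/
def kinv (t : ℝˣ) : U t := gen t Gen.kinv

lemma k_mul_kinv : k t * kinv t = 1 := by
  simpa [k, kinv, gen] using mk_rel (Rel.k_kinv (t := t))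

lemma kinv_mul_k : kinv t * k t = 1 := by
  simpa [k, kinv, gen] using mk_rel (Rel.kinv_k (t := t))

lemma k_mul_e : k t * e t = ((t : ℝ) : ℂ) ^ (2 : ℤ) • (e t * k t) := by
  simpa only [map_mul, map_smul, e, f, k, kinv, gen] using mk_rel (Rel.k_e (t := t))

lemma k_mul_f : k t * f t = ((t : ℝ) : ℂ) ^ (-2 : ℤ) • (f t * k t) := by
  simpa only [map_mul, map_smul, e, f, k, kinv, gen] using mk_rel (Rel.k_f (t := t))

lemma e_mul_f : e t * f t - f t * e t =
    (((t : ℝ) : ℂ) ^ (2 : ℤ) - ((t : ℝ) : ℂ) ^ (-2 : ℤ))⁻¹ • (k t ^ 2 - kinv t ^ 2) := by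
  simpa only [map_mul, map_smul, map_sub, map_pow, e, f, k, kinv, gen] using mk_rel (Rel.e_f (t := t))

/-- The universal property of `U t`. -/
def lift {B : Type*} [Ring B] [Algebra ℂ B] (E F K K' : B)
    (h₁ : K * K' = 1) (h₂ : K' * K = 1)
    (h₃ : K * E = ((t : ℝ) : ℂ) ^ (2 : ℤ) • (E * K))
    (h₄ : K * F = ((t : ℝ) : ℂ) ^ (-2 : ℤ) • (F * K))
    (h₅ : E * F - F * E =
      (((t : ℝ) : ℂ) ^ (2 : ℤ) - ((t : ℝ) : ℂ) ^ (-2 : ℤ))⁻¹ • (K ^ 2 - K' ^ 2)) :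
    U t →ₐ[ℂ] B :=
  (RingQuot.liftAlgHom ℂ ⟨FreeAlgebra.lift ℂ (fun g => match g with
    | Gen.e => E
    | Gen.f => F
    | Gen.k => K
    | Gen.kinv => K'), by
      intro x y h
      induction h with
      | k_kinv => simpa using h₁
      | kinv_k => simpa using h₂
      | k_e => simpa only [map_mul, map_smul, FreeAlgebra.lift_ι_apply] using h₃
      | k_f => simpa only [map_mul, map_smul, FreeAlgebra.lift_ι_apply] using h₄
      | e_f => simpa only [map_mul, map_smul, map_sub, map_pow, FreeAlgebra.lift_ι_apply] using h₅⟩ :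
    RingQuot (Rel t) →ₐ[ℂ] B)

section lift
variable {B : Type*} [Ring B] [Algebra ℂ B] {E F K K' : B}
    {h₁ : K * K' = 1} {h₂ : K' * K = 1}
    {h₃ : K * E = ((t : ℝ) : ℂ) ^ (2 : ℤ) • (E * K)}
    {h₄ : K * F = ((t : ℝ) : ℂ) ^ (-2 : ℤ) • (F * K)}
    {h₅ : E * F - F * E =
      (((t : ℝ) : ℂ) ^ (2 : ℤ) - ((t : ℝ) : ℂ) ^ (-2 : ℤ))⁻¹ • (K ^ 2 - K' ^ 2)}

@[simp] lemma lift_e : lift (t := t) E F K K' h₁ h₂ h₃ h₄ h₅ (e t) = E :=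
  (RingQuot.liftAlgHom_mkAlgHom_apply ℂ _ _ _).trans (FreeAlgebra.lift_ι_apply _ _)
@[simp] lemma lift_f : lift (t := t) E F K K' h₁ h₂ h₃ h₄ h₅ (f t) = F :=
  (RingQuot.liftAlgHom_mkAlgHom_apply ℂ _ _ _).trans (FreeAlgebra.lift_ι_apply _ _)
@[simp] lemma lift_k : lift (t := t) E F K K' h₁ h₂ h₃ h₄ h₅ (k t) = K :=
  (RingQuot.liftAlgHom_mkAlgHom_apply ℂ _ _ _).trans (FreeAlgebra.lift_ι_apply _ _)
@[simp] lemma lift_kinv : lift (t := t) E F K K' h₁ h₂ h₃ h₄ h₅ (kinv t) = K' :=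
  (RingQuot.liftAlgHom_mkAlgHom_apply ℂ _ _ _).trans (FreeAlgebra.lift_ι_apply _ _)
end lift

lemma algHom_ext {B : Type*} [Semiring B] [Algebra ℂ B] {φ ψ : U t →ₐ[ℂ] B}
    (he : φ (e t) = ψ (e t)) (hf : φ (f t) = ψ (f t)) (hk : φ (k t) = ψ (k t))
    (hk' : φ (kinv t) = ψ (kinv t)) : φ = ψ := by
  refine RingQuot.ringQuot_ext' (S := ℂ) (s := Rel t) (B := B) φ ψ ?_
  apply FreeAlgebra.hom_ext
  funext g
  cases g
  · exact he
  · exact hf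
  · exact hk
  · exact hk'

lemma t_ne (t : ℝˣ) : ((t : ℝ) : ℂ) ≠ 0 := by exact_mod_cast t.ne_zero

lemma t_zpow (t : ℝˣ) :
    ((t : ℝ) : ℂ) ^ (2 : ℤ) * ((t : ℝ) : ℂ) ^ (-2 : ℤ) = 1 := by
  rw [← zpow_add₀ (t_ne t)]; simp

lemma kinv_mul_e : kinv t * e t = ((t : ℝ) : ℂ) ^ (-2 : ℤ) • (e t * kinv t) := by
  have h : kinv t * (k t * e t) * kinv t =
      kinv t * (((t : ℝ) : ℂ) ^ (2 : ℤ) • (e t * k t)) * kinv t := by rw [k_mul_e]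
  rw [← mul_assoc, kinv_mul_k, one_mul, mul_smul_comm, smul_mul_assoc, mul_assoc (kinv t),
    mul_assoc (e t), k_mul_kinv, mul_one] at h
  rw [h, smul_smul, mul_comm, t_zpow, one_smul]

lemma kinv_mul_f : kinv t * f t = ((t : ℝ) : ℂ) ^ (2 : ℤ) • (f t * kinv t) := by
  have h : kinv t * (k t * f t) * kinv t =
      kinv t * (((t : ℝ) : ℂ) ^ (-2 : ℤ) • (f t * k t)) * kinv t := by rw [k_mul_f]
  rw [← mul_assoc, kinv_mul_k, one_mul, mul_smul_comm, smul_mul_assoc, mul_assoc (kinv t),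
    mul_assoc (f t), k_mul_kinv, mul_one] at h
  rw [h, smul_smul, t_zpow, one_smul]

/-- The coproduct: `Δ(e) = e ⊗ k⁻¹ + k ⊗ e`, `Δ(f) = f ⊗ k⁻¹ + k ⊗ f`, `Δ(k^{±1}) = k^{±1} ⊗ k^{±1}`. -/
def Δ (t : ℝˣ) : U t →ₐ[ℂ] U t ⊗[ℂ] U t :=
  lift (t := t) (e t ⊗ₜ[ℂ] kinv t + k t ⊗ₜ[ℂ] e t) (f t ⊗ₜ[ℂ] kinv t + k t ⊗ₜ[ℂ] f t)
    (k t ⊗ₜ[ℂ] k t) (kinv t ⊗ₜ[ℂ] kinv t)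
    (by simp [k_mul_kinv, Algebra.TensorProduct.one_def])
    (by simp [kinv_mul_k, Algebra.TensorProduct.one_def])
    (by
      simp only [mul_add, add_mul, Algebra.TensorProduct.tmul_mul_tmul, k_mul_e, k_mul_kinv,
        kinv_mul_k, smul_add, TensorProduct.smul_tmul', TensorProduct.tmul_smul])
    (by
      simp only [mul_add, add_mul, Algebra.TensorProduct.tmul_mul_tmul, k_mul_f, k_mul_kinv,
        kinv_mul_k, smul_add, TensorProduct.smul_tmul', TensorProduct.tmul_smul])
    (by
      have h := e_mul_f (t := t)
      have h' : e t * f t = f t * e t + (((t : ℝ) : ℂ) ^ (2 : ℤ) - ((t : ℝ) : ℂ) ^ (-2 : ℤ))⁻¹ •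
        (k t ^ 2 - kinv t ^ 2) := by rw [← h]; abel
      simp only [mul_add, add_mul, Algebra.TensorProduct.tmul_mul_tmul, pow_two, h', k_mul_e,
        k_mul_f, kinv_mul_e, kinv_mul_f, smul_sub, TensorProduct.smul_tmul',
        TensorProduct.tmul_smul, TensorProduct.add_tmul, TensorProduct.tmul_add,
        TensorProduct.sub_tmul, TensorProduct.tmul_sub]
      abel)

/-- The counit. -/
def ε (t : ℝˣ) : U t →ₐ[ℂ] ℂ :=
  lift (t := t) 0 0 1 1 (by simp) (by simp) (by simp) (by simp) (by simp)

/-- The antipode, as an algebra homomorphism to the opposite algebra: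
`S(e) = -t⁻² e`, `S(f) = -t² f`, `S(k^{±1}) = k^{∓1}`. -/
def S (t : ℝˣ) : U t →ₐ[ℂ] (U t)ᵐᵒᵖ :=
  lift (t := t) (MulOpposite.op (-(((t : ℝ) : ℂ) ^ (-2 : ℤ) • e t)))
    (MulOpposite.op (-(((t : ℝ) : ℂ) ^ (2 : ℤ) • f t)))
    (MulOpposite.op (kinv t)) (MulOpposite.op (k t))
    (by rw [← MulOpposite.op_mul, k_mul_kinv, MulOpposite.op_one])
    (by rw [← MulOpposite.op_mul, kinv_mul_k, MulOpposite.op_one])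
    (by
      apply MulOpposite.unop_injective
      simp only [MulOpposite.unop_mul, MulOpposite.unop_smul, MulOpposite.unop_op, neg_mul,
        mul_neg, smul_mul_assoc, mul_smul_comm, kinv_mul_e, smul_neg, smul_smul]
      rw [← mul_assoc, t_zpow, one_mul])
    (by
      apply MulOpposite.unop_injective
      simp only [MulOpposite.unop_mul, MulOpposite.unop_smul, MulOpposite.unop_op, neg_mul,
        mul_neg, smul_mul_assoc, mul_smul_comm, kinv_mul_f, smul_neg, smul_smul]
      rw [mul_comm, mul_assoc, t_zpow, mul_one])
    (by
      apply MulOpposite.unop_injective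
      simp only [MulOpposite.unop_mul, MulOpposite.unop_smul, MulOpposite.unop_op,
        MulOpposite.unop_sub, MulOpposite.unop_pow, neg_mul,
        mul_neg, smul_mul_assoc, mul_smul_comm, neg_neg, smul_neg, smul_smul]
      rw [t_zpow, mul_comm (((t : ℝ) : ℂ) ^ (-2 : ℤ)), t_zpow, one_smul, one_smul,
        ← neg_sub (e t * f t), e_mul_f, ← smul_neg, neg_sub])

instance instBialgebra (t : ℝˣ) : Bialgebra ℂ (U t) :=
  Bialgebra.ofAlgHom (Δ t) (ε t)
    (by
      apply algHom_ext <;>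
      simp [Δ, TensorProduct.add_tmul, TensorProduct.tmul_add, add_assoc])
    (by apply algHom_ext <;> simp [Δ, ε])
    (by apply algHom_ext <;> simp [Δ, ε])

lemma comul_eq (x : U t) : Coalgebra.comul (R := ℂ) x = Δ t x := rfl

lemma counit_eq (x : U t) : Coalgebra.counit (R := ℂ) x = ε t x := rfl

/-- An induction principle for elements of `U t`. -/
lemma U_induction {P : U t → Prop} (hc : ∀ c : ℂ, P (algebraMap ℂ (U t) c))
    (he : P (e t)) (hf : P (f t)) (hk : P (k t)) (hk' : P (kinv t))
    (hadd : ∀ a b, P a → P b → P (a + b)) (hmul : ∀ a b, P a → P b → P (a * b)) (a : U t) :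
    P a := by
  obtain ⟨x, rfl⟩ : ∃ x, mk t x = a := RingQuot.mkAlgHom_surjective ℂ (Rel t) a
  induction x using FreeAlgebra.induction with
  | grade0 c => rw [AlgHom.commutes]; exact hc c
  | grade1 g =>
    cases g
    · exact he
    · exact hf
    · exact hk
    · exact hk'
  | mul x y hx hy => rw [map_mul]; exact hmul _ _ hx hy
  | add x y hx hy => rw [map_add]; exact hadd _ _ hx hy

/-- The antipode as a linear map. -/
def antipode (t : ℝˣ) : U t →ₗ[ℂ] U t :=
  (MulOpposite.opLinearEquiv ℂ).symm.toLinearMap ∘ₗ (S t).toLinearMap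

lemma antipode_mul (a b : U t) : antipode t (a * b) = antipode t b * antipode t a := by
  simp [antipode]

lemma antipode_algebraMap (c : ℂ) :
    antipode t (algebraMap ℂ (U t) c) = algebraMap ℂ (U t) c := by
  simp [antipode]

lemma antipode_one : antipode t 1 = 1 := by simp [antipode]

lemma antipode_e : antipode t (e t) = -(((t : ℝ) : ℂ) ^ (-2 : ℤ) • e t) := by
  simp [antipode, S]
lemma antipode_f : antipode t (f t) = -(((t : ℝ) : ℂ) ^ (2 : ℤ) • f t) := by
  simp [antipode, S]
lemma antipode_k : antipode t (k t) = kinv t := by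
  simp [antipode, S]
lemma antipode_kinv : antipode t (kinv t) = k t := by
  simp [antipode, S]

lemma rTensor_mul (x y : U t ⊗[ℂ] U t) (c : ℂ)
    (hx : LinearMap.mul' ℂ (U t) ((antipode t).rTensor (U t) x) = algebraMap ℂ (U t) c) :
    LinearMap.mul' ℂ (U t) ((antipode t).rTensor (U t) (x * y)) =
      algebraMap ℂ (U t) c * LinearMap.mul' ℂ (U t) ((antipode t).rTensor (U t) y) := by
  induction y with
  | zero => simp
  | add y z hy hz => simp only [mul_add, map_add, hy, hz]
  | tmul y₁ y₂ =>
    have key : LinearMap.mul' ℂ (U t) ((antipode t).rTensor (U t) (x * (y₁ ⊗ₜ[ℂ] y₂))) =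
        antipode t y₁ * LinearMap.mul' ℂ (U t) ((antipode t).rTensor (U t) x) * y₂ := by
      clear hx
      induction x with
      | zero => simp
      | add x z hx hz => simp only [mul_add, add_mul, map_add, hx, hz]
      | tmul x₁ x₂ => simp [antipode_mul, mul_assoc]
    rw [key, hx, ← Algebra.commutes c (antipode t y₁)]
    simp [mul_assoc]

lemma lTensor_mul (x y : U t ⊗[ℂ] U t) (c : ℂ)
    (hy : LinearMap.mul' ℂ (U t) ((antipode t).lTensor (U t) y) = algebraMap ℂ (U t) c) :
    LinearMap.mul' ℂ (U t) ((antipode t).lTensor (U t) (x * y)) =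
      LinearMap.mul' ℂ (U t) ((antipode t).lTensor (U t) x) * algebraMap ℂ (U t) c := by
  induction x with
  | zero => simp
  | add x z hx hz => simp only [add_mul, map_add, hx, hz]
  | tmul x₁ x₂ =>
    have key : LinearMap.mul' ℂ (U t) ((antipode t).lTensor (U t) ((x₁ ⊗ₜ[ℂ] x₂) * y)) =
        x₁ * LinearMap.mul' ℂ (U t) ((antipode t).lTensor (U t) y) * antipode t x₂ := by
      clear hy
      induction y with
      | zero => simp
      | add y z hy hz => simp only [mul_add, add_mul, map_add, hy, hz]
      | tmul y₁ y₂ => simp [antipode_mul, mul_assoc]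
    rw [key, hy, mul_assoc, Algebra.commutes c (antipode t x₂), ← mul_assoc]
    simp

/-- The Hopf algebra `U_t(su(2))`. -/
instance instHopfAlgebra (t : ℝˣ) : HopfAlgebra ℂ (U t) where
  antipode := antipode t
  mul_antipode_rTensor_comul := by
    ext a
    simp only [LinearMap.comp_apply, comul_eq, counit_eq, Algebra.linearMap_apply]
    induction a using U_induction with
    | hc c => simp [Algebra.TensorProduct.algebraMap_apply, antipode_algebraMap]
    | he => simp [Δ, ε, antipode_e, antipode_k, kinv_mul_e]
    | hf => simp [Δ, ε, antipode_f, antipode_k, kinv_mul_f]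
    | hk => simp [Δ, ε, antipode_k, kinv_mul_k]
    | hk' => simp [Δ, ε, antipode_kinv, k_mul_kinv]
    | hadd a b ha hb => simp only [map_add, ha, hb]
    | hmul a b ha hb => rw [map_mul, rTensor_mul _ _ _ ha, hb, ← map_mul, ← map_mul]
  mul_antipode_lTensor_comul := by
    ext a
    simp only [LinearMap.comp_apply, comul_eq, counit_eq, Algebra.linearMap_apply]
    induction a using U_induction with
    | hc c => simp [Algebra.TensorProduct.algebraMap_apply, antipode_one]
    | he =>
      simp [Δ, ε, antipode_e, antipode_kinv, k_mul_e, smul_smul, t_ne t]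
    | hf =>
      simp [Δ, ε, antipode_f, antipode_kinv, k_mul_f, smul_smul, t_ne t]
    | hk => simp [Δ, ε, antipode_k, k_mul_kinv]
    | hk' => simp [Δ, ε, antipode_kinv, kinv_mul_k]
    | hadd a b ha hb => simp only [map_add, ha, hb]
    | hmul a b ha hb => rw [map_mul, lTensor_mul _ _ _ hb, ha, ← map_mul, ← map_mul]

/-! ### `q`-numbers and the irreducible representations -/

/-- `[n] = (t^{2n} - t^{-2n}) / (t² - t⁻²)`. -/
def qnum (t : ℝˣ) (n : ℤ) : ℝ :=
  ((t : ℝ) ^ (2 * n) - (t : ℝ) ^ (-(2 * n))) / ((t : ℝ) ^ (2 : ℤ) - (t : ℝ) ^ (-2 : ℤ))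

/-- `[n]! = [1][2]⋯[n]`. -/
def qfact (t : ℝˣ) (n : ℕ) : ℝ := ∏ i ∈ Finset.range n, qnum t (i + 1)

/-- The underlying space of the irreducible representation `V^j`, where `N = 2j`. The weight basis
vector `e_m`, `m = j, j - 1, …, -j`, is the standard basis vector with index `j - m ∈ {0, …, 2j}`. -/
abbrev V (N : ℕ) : Type := Fin (N + 1) → ℂ

/-- The weight basis vector `e_m` of `V^j`, with `N = 2j` and `s = j - m`. -/
def wt (N : ℕ) (s : Fin (N + 1)) : V N := Pi.single s 1

/-- Matrix of `e`: `e e_m = ([j-m][j+m+1])^{1/2} e_{m+1}`; here `N = 2j`, `b = j - m`. -/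
def eMat (t : ℝˣ) (N : ℕ) : Matrix (Fin (N + 1)) (Fin (N + 1)) ℂ :=
  Matrix.of fun a b => if (a : ℕ) + 1 = b then
    ((Real.sqrt (qnum t b * qnum t (N - b + 1)) : ℝ) : ℂ) else 0

/-- Matrix of `f`: `f e_m = ([j+m][j-m+1])^{1/2} e_{m-1}`; here `N = 2j`, `b = j - m`. -/
def fMat (t : ℝˣ) (N : ℕ) : Matrix (Fin (N + 1)) (Fin (N + 1)) ℂ :=
  Matrix.of fun a b => if (a : ℕ) = b + 1 then
    ((Real.sqrt (qnum t (N - b) * qnum t (b + 1)) : ℝ) : ℂ) else 0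

/-- Matrix of `k` (`σ = 1`) and of `k⁻¹` (`σ = -1`): `k^σ e_m = t^{2σm} e_m`; here `N = 2j` and
`b = j - m`, so that `2m = N - 2b`. -/
def kMat (t : ℝˣ) (N : ℕ) (σ : ℤ) : Matrix (Fin (N + 1)) (Fin (N + 1)) ℂ :=
  Matrix.diagonal fun b => ((t : ℝ) : ℂ) ^ (σ * ((N : ℤ) - 2 * (b : ℤ)))

lemma qnum_nonneg (t : ℝˣ) (n : ℕ) : 0 ≤ qnum t n := by
  have ht : (t : ℝ) ≠ 0 := t.ne_zero
  set x : ℝ := (t : ℝ) ^ (2 : ℤ) with hx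
  have hx0 : 0 < x := by positivity
  have h1 : (t : ℝ) ^ (2 * (n : ℤ)) = x ^ n := by rw [zpow_mul, zpow_natCast]
  have h2 : (t : ℝ) ^ (-(2 * (n : ℤ))) = (x ^ n)⁻¹ := by rw [zpow_neg, h1]
  have h3 : (t : ℝ) ^ (-2 : ℤ) = x⁻¹ := by rw [zpow_neg]
  rw [qnum, h1, h2, h3, ← hx]
  rcases le_total 1 x with h | h
  · have a1 : (x ^ n)⁻¹ ≤ x ^ n := (inv_le_one_of_one_le₀ (one_le_pow₀ h)).trans (one_le_pow₀ h)
    have a2 : x⁻¹ ≤ x := (inv_le_one_of_one_le₀ h).trans h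
    exact div_nonneg (by linarith) (by linarith)
  · have b1 : x ^ n ≤ 1 := pow_le_one₀ hx0.le h
    have a1 : x ^ n ≤ (x ^ n)⁻¹ := b1.trans ((one_le_inv₀ (by positivity)).2 b1)
    have a2 : x ≤ x⁻¹ := h.trans ((one_le_inv₀ hx0).2 h)
    exact div_nonneg_of_nonpos (by linarith) (by linarith)

lemma eMat_mul_fMat_apply (t : ℝˣ) (N : ℕ) (a b : Fin (N + 1)) :
    (eMat t N * fMat t N) a b =
      if a = b then ((qnum t (a + 1) * qnum t (N - a) : ℝ) : ℂ) else 0 := by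
  rw [Matrix.mul_apply]
  by_cases ha : (a : ℕ) < N
  · rw [Finset.sum_eq_single (⟨a + 1, by omega⟩ : Fin (N + 1))]
    · by_cases hab : a = b
      · subst hab
        have h1 := qnum_nonneg t (a + 1)
        have h2 := qnum_nonneg t (N - a)
        rw [Nat.cast_sub ha.le] at h2
        push_cast at h1
        simp only [eMat, fMat, Matrix.of_apply, if_true]
        rw [← Complex.ofReal_mul]
        congr 1
        push_cast
        rw [show (N : ℤ) - ((a : ℕ) + 1 : ℤ) + 1 = N - (a : ℕ) by ring,
          mul_comm (qnum t (N - (a : ℕ))), Real.mul_self_sqrt (mul_nonneg h1 h2)]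
      · have hab' : (a : ℕ) ≠ b := fun h => hab (Fin.ext h)
        simp [eMat, fMat, hab, hab']
    · intro c _ hc
      have : ¬ ((a : ℕ) + 1 = c) := fun h => hc (Fin.ext h.symm)
      simp [eMat, this]
    · simp
  · have haN : (a : ℕ) = N := by omega
    rw [Finset.sum_eq_zero]
    · simp [haN, qnum]
    · intro c _
      have : ¬ ((a : ℕ) + 1 = c) := by omega
      simp [eMat, this]

lemma fMat_mul_eMat_apply (t : ℝˣ) (N : ℕ) (a b : Fin (N + 1)) :
    (fMat t N * eMat t N) a b =
      if a = b then ((qnum t a * qnum t (N - a + 1) : ℝ) : ℂ) else 0 := by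
  rw [Matrix.mul_apply]
  by_cases ha : 0 < (a : ℕ)
  · rw [Finset.sum_eq_single (⟨a - 1, by omega⟩ : Fin (N + 1))]
    · by_cases hab : a = b
      · subst hab
        have h1 := qnum_nonneg t a
        have h2 := qnum_nonneg t (N - a + 1 : ℕ)
        rw [Nat.cast_add, Nat.cast_sub (by omega)] at h2
        push_cast at h2
        have h3 : (a : ℕ) - 1 + 1 = a := by omega
        have h4 : (((a : ℕ) - 1 : ℕ) : ℤ) = (a : ℕ) - 1 := by omega
        simp only [eMat, fMat, Matrix.of_apply, h3, if_true, h4]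
        rw [← Complex.ofReal_mul]
        congr 1
        rw [show (N : ℤ) - ((a : ℕ) - 1 : ℤ) = N - (a : ℕ) + 1 by ring,
          show ((a : ℕ) - 1 + 1 : ℤ) = (a : ℕ) by ring,
          mul_comm (qnum t (N - (a : ℕ) + 1)), Real.mul_self_sqrt (mul_nonneg h1 h2)]
      · have hab' : ¬ ((a : ℕ) - 1 + 1 = b) := fun h => hab (Fin.ext (by omega))
        simp [eMat, fMat, hab, hab']
    · intro c _ hc
      have : ¬ ((a : ℕ) = c + 1) := fun h => hc (Fin.ext (by simp; omega))
      simp [fMat, this]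
    · simp
  · have ha0 : (a : ℕ) = 0 := by omega
    rw [Finset.sum_eq_zero]
    · simp [ha0, qnum]
    · intro c _
      have : ¬ ((a : ℕ) = c + 1) := by omega
      simp [fMat, this]

lemma qnum_identity (t : ℝˣ) (N a : ℤ) :
    qnum t (a + 1) * qnum t (N - a) - qnum t a * qnum t (N - a + 1) =
      ((t : ℝ) ^ (2 : ℤ) - (t : ℝ) ^ (-2 : ℤ))⁻¹ *
        ((t : ℝ) ^ (2 * (N - 2 * a)) - (t : ℝ) ^ (-(2 * (N - 2 * a)))) := by
  have ht : (t : ℝ) ≠ 0 := t.ne_zero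
  have key : ((t : ℝ) ^ (2 * (a + 1)) - (t : ℝ) ^ (-(2 * (a + 1)))) *
        ((t : ℝ) ^ (2 * (N - a)) - (t : ℝ) ^ (-(2 * (N - a)))) -
      ((t : ℝ) ^ (2 * a) - (t : ℝ) ^ (-(2 * a))) *
        ((t : ℝ) ^ (2 * (N - a + 1)) - (t : ℝ) ^ (-(2 * (N - a + 1)))) =
      ((t : ℝ) ^ (2 : ℤ) - (t : ℝ) ^ (-2 : ℤ)) *
        ((t : ℝ) ^ (2 * (N - 2 * a)) - (t : ℝ) ^ (-(2 * (N - 2 * a)))) := by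
    simp only [mul_sub, sub_mul, ← zpow_add₀ ht]
    ring_nf
  simp only [qnum]
  generalize (t : ℝ) ^ (2 : ℤ) - (t : ℝ) ^ (-2 : ℤ) = d at key ⊢
  by_cases hd : d = 0
  · simp [hd]
  · rw [div_mul_div_comm, div_mul_div_comm, ← sub_div, key]
    field_simp

/-- The irreducible representation `(V^j, π^j)`, with `N = 2j`. -/
def irrep (t : ℝˣ) (N : ℕ) : U t →ₐ[ℂ] Module.End ℂ (V N) :=
  (Matrix.toLinAlgEquiv' : Matrix (Fin (N + 1)) (Fin (N + 1)) ℂ ≃ₐ[ℂ] _).toAlgHom.comp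
    (lift (t := t) (eMat t N) (fMat t N) (kMat t N 1) (kMat t N (-1))
      (by
        simp only [kMat, Matrix.diagonal_mul_diagonal, ← zpow_add₀ (t_ne t)]
        simp)
      (by
        simp only [kMat, Matrix.diagonal_mul_diagonal, ← zpow_add₀ (t_ne t)]
        simp)
      (by
        ext a b
        simp only [kMat, Matrix.diagonal_mul, Matrix.mul_diagonal, Matrix.smul_apply, smul_eq_mul,
          eMat, Matrix.of_apply]
        split_ifs with h
        · rw [mul_comm, mul_left_comm, ← zpow_add₀ (t_ne t), ← h]
          congr 2
          push_cast
          ring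
        · simp)
      (by
        ext a b
        simp only [kMat, Matrix.diagonal_mul, Matrix.mul_diagonal, Matrix.smul_apply, smul_eq_mul,
          fMat, Matrix.of_apply]
        split_ifs with h
        · rw [mul_comm, mul_left_comm, ← zpow_add₀ (t_ne t), h]
          congr 2
          push_cast
          ring
        · simp)
      (by
        ext a b
        rw [Matrix.sub_apply, eMat_mul_fMat_apply, fMat_mul_eMat_apply]
        simp only [kMat, pow_two, Matrix.diagonal_mul_diagonal, Matrix.smul_apply,
          Matrix.sub_apply, Matrix.diagonal_apply, ← zpow_add₀ (t_ne t), smul_eq_mul]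
        split_ifs with h
        · rw [← Complex.ofReal_sub, qnum_identity]
          push_cast
          ring_nf
        · simp))

/-- The matrix element `π^j(a)_{mn}` in the weight basis: `π^j(a) e_n = ∑ₘ π^j(a)_{mn} e_m`. -/
def matEl (t : ℝˣ) (N : ℕ) (a : U t) (m n : Fin (N + 1)) : ℂ := irrep t N a (wt N n) m

/-! ### The elements `λ^l_m` -/

/-- The elements `λ^l_m = ([l+m]! / ([2l]! [l-m]!))^{1/2} (ad f)^{l-m} (e^l k^{-l})` of
`U_t(su(2))`, with `s = l - m`. -/
def lam (t : ℝˣ) (l : ℕ) (s : Fin (2 * l + 1)) : U t :=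
  ((Real.sqrt (qfact t (2 * l - s) / (qfact t (2 * l) * qfact t s)) : ℝ) : ℂ) •
    ((HopfRep.ad (U t) (f t)) ^ (s : ℕ)) (e t ^ l * kinv t ^ l)

/-- The subspace `U^l` of `U_t(su(2))`. -/
def Ul (t : ℝˣ) (l : ℕ) : Submodule ℂ (U t) := Submodule.span ℂ (Set.range (lam t l))

/-! ### Clebsch-Gordan coefficients -/

/-- `C p n m` are the Clebsch-Gordan coefficients `(κ p, ℓ n | j m)_t` of the component `V^j` of
`V^κ ⊗ V^ℓ`, where `K = 2κ`, `L = 2ℓ`, `J = 2j` and weights are indexed as in `V N`.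

In the Clebsch-Gordan decomposition `e_p ⊗ e_n = ∑ⱼ ∑ₘ (κ p, ℓ n | j m)_t e^j_m` the `V^j`-part is
the projection `T : V^κ ⊗ V^ℓ → V^j`, `T (e_p ⊗ e_n) = ∑ₘ (κ p, ℓ n | j m)_t e_m`, which is a
homomorphism of representations; the coupled vectors
`e^j_m = ∑_{p,n} (κ p, ℓ n | j m)_t e_p ⊗ e_n` are orthonormal (for the scalar product in which the
`e_p ⊗ e_n` are orthonormal). These two conditions determine the coefficients, which are real, up
to a common sign. For `t > 0` the sign is the usual one, `(κ κ, ℓ (j-κ) | j j)_t > 0`; in general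
`(κ κ, ℓ (j-κ) | j j)_t` has the sign of `t^{-(κ+ℓ-j)(j+ℓ-κ+1)}`, as in the closed formulae for
the coefficients. -/
structure IsClebschGordan (t : ℝˣ) (K L J : ℕ)
    (C : Fin (K + 1) → Fin (L + 1) → Fin (J + 1) → ℝ) : Prop where
  exists_hom : ∃ T : V K ⊗[ℂ] V L →ₗ[ℂ] V J,
    (∀ p n, T (wt K p ⊗ₜ[ℂ] wt L n) = ∑ m, (C p n m : ℂ) • wt J m) ∧
    ∀ a : U t, T ∘ₗ HopfRep.tensorRep (irrep t K) (irrep t L) a = irrep t J a ∘ₗ T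
  orthonormal : ∀ m m', ∑ p, ∑ n, C p n m * C p n m' = if m = m' then 1 else 0
  phase : ∀ n : Fin (L + 1), K + L = J + 2 * n → 0 < (t : ℝ) ^ ((n : ℕ) * (L + 1 - n)) * C 0 n 0

open Classical in
/-- The Clebsch-Gordan coefficients `(κ p, ℓ n | j m)_t`, with `K = 2κ`, `L = 2ℓ`, `J = 2j`; they
are zero when `V^j` does not occur in `V^κ ⊗ V^ℓ`. -/
def cg (t : ℝˣ) (K L J : ℕ) : Fin (K + 1) → Fin (L + 1) → Fin (J + 1) → ℝ :=
  if h : ∃ C, IsClebschGordan t K L J C then h.choose else 0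

/-- `α = t^{l(l+1)} [l]! ([2j+l+1]! / ([2l]! [2j-l]! [2j+1]))^{1/2}`, with `N = 2j` and `l ≤ 2j`. -/
def reducedMatrixElement (t : ℝˣ) (l N : ℕ) : ℝ :=
  (t : ℝ) ^ (l * (l + 1)) * qfact t l *
    Real.sqrt (qfact t (N + l + 1) / (qfact t (2 * l) * qfact t (N - l) * qnum t (N + 1)))

end QuantumSU2

end

/-!
Because `ad` satisfies `∑ ad_{a₍₁₎}(b) a₍₂₎ = a b`, the map `λ ⊗ x ↦ π^j(λ) x` intertwines
`U^l ⊗ V^j` with `V^j`. Here `U^l` is a copy of `V^l`: the vector `e k⁻¹` is a highest weight vector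
for `ad` killed by `(ad_f)³`, and since multiplication intertwines `ad ⊗ ad` with `ad`, its powers,
which are multiples of `e^l k^{-l}`, are highest weight vectors killed by `(ad_f)^{2l+1}`.

The relation for `f` determines the highest weight row of an intertwiner `V^l ⊗ V^j → V^j`, and
hence, `V^j` being irreducible, the whole intertwiner, from the single entry at `e_l ⊗ e_{j-l}`. So
the matrix elements of `λ^l_p` are proportional to the Clebsch–Gordan coefficients, and both vanish
if `l > 2j`. By Schur's lemma the composite of an intertwiner with its transpose is a scalar, the
squared norm of the highest weight row; the `q`-Vandermonde identity evaluates this norm in terms of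
the single entry, which is read off from `e^l k^{-l}`. This gives `α`, with `α > 0` by the phase
convention.
-/

noncomputable section

lemma mul_pow_of_mul_eq_smul {R A : Type*} [CommSemiring R] [Semiring A] [Algebra R A] {x y : A}
    {c : R} (h : x * y = c • (y * x)) (n : ℕ) : x * y ^ n = c ^ n • (y ^ n * x) := by
  induction n with
  | zero => simp
  | succ n ih =>
    rw [pow_succ, ← mul_assoc, ih, smul_mul_assoc, mul_assoc, h, mul_smul_comm, smul_smul,
      mul_assoc, pow_succ]

lemma pow_mul_of_mul_eq_smul {R A : Type*} [CommSemiring R] [Semiring A] [Algebra R A] {x y : A}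
    {c : R} (h : x * y = c • (y * x)) (n : ℕ) : x ^ n * y = c ^ n • (y * x ^ n) := by
  induction n with
  | zero => simp
  | succ n ih =>
    rw [pow_succ, mul_assoc, h, mul_smul_comm, ← mul_assoc, ih, smul_mul_assoc, smul_smul,
      mul_assoc, pow_succ']

namespace HopfRep

/-! ### Intertwiners -/

section Intertwines

variable {A V W X : Type*} [Ring A] [Algebra ℂ A] [AddCommGroup V] [Module ℂ V]
  [AddCommGroup W] [Module ℂ W] [AddCommGroup X] [Module ℂ X]
  {ρ : A →ₐ[ℂ] Module.End ℂ V} {σ : A →ₐ[ℂ] Module.End ℂ W} {τ : A →ₐ[ℂ] Module.End ℂ X}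

/-- `T` is a homomorphism from the representation `ρ` to the representation `σ`. -/
def Intertwines (ρ : A →ₐ[ℂ] Module.End ℂ V) (σ : A →ₐ[ℂ] Module.End ℂ W) (T : V →ₗ[ℂ] W) : Prop :=
  ∀ a, T ∘ₗ ρ a = σ a ∘ₗ T

namespace Intertwines

variable {T T' : V →ₗ[ℂ] W}

lemma apply (hT : Intertwines ρ σ T) (a : A) (x : V) : T (ρ a x) = σ a (T x) :=
  LinearMap.congr_fun (hT a) x

lemma sub (hT : Intertwines ρ σ T) (hT' : Intertwines ρ σ T') : Intertwines ρ σ (T - T') := by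
  intro a
  rw [LinearMap.sub_comp, LinearMap.comp_sub, hT, hT']

lemma smul (hT : Intertwines ρ σ T) (c : ℂ) : Intertwines ρ σ (c • T) := by
  intro a
  rw [LinearMap.smul_comp, LinearMap.comp_smul, hT]

lemma comp {R : W →ₗ[ℂ] X} (hR : Intertwines σ τ R) (hT : Intertwines ρ σ T) :
    Intertwines ρ τ (R ∘ₗ T) := by
  intro a
  rw [LinearMap.comp_assoc, hT, ← LinearMap.comp_assoc, hR, LinearMap.comp_assoc]

lemma id : Intertwines ρ ρ LinearMap.id := fun _ => rfl

end Intertwines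

end Intertwines

section Irreducible

variable {A V W : Type*} [Ring A] [HopfAlgebra ℂ A] [AddCommGroup V] [Module ℂ V]
  [AddCommGroup W] [Module ℂ W] {ρ : A →ₐ[ℂ] Module.End ℂ V} {σ : A →ₐ[ℂ] Module.End ℂ W}
  {T : V →ₗ[ℂ] W}

namespace Intertwines

lemma isIrreducibleOn_range (hT : Intertwines ρ σ T) (hρ : IsIrreducibleOn ρ ⊤) (h0 : T ≠ 0) :
    IsIrreducibleOn σ (LinearMap.range T) where
  ne_bot := by rwa [Ne, LinearMap.range_eq_bot]
  invariant := by
    rintro a _ ⟨x, rfl⟩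
    exact ⟨ρ a x, hT.apply a x⟩
  eq_bot_or_eq S' hS' hinv := by
    have hcomap := hρ.eq_bot_or_eq (S'.comap T) le_top fun a x hx => by
      rw [Submodule.mem_comap, hT.apply]
      exact hinv a _ hx
    rw [← Submodule.map_comap_eq_of_le hS']
    exact hcomap.imp (fun h => by rw [h, Submodule.map_bot])
      fun h => by rw [h, LinearMap.range_eq_map]

lemma ker_eq_bot (hT : Intertwines ρ σ T) (hρ : IsIrreducibleOn ρ ⊤) (h0 : T ≠ 0) :
    LinearMap.ker T = ⊥ := by
  refine (hρ.eq_bot_or_eq _ le_top fun a x hx => ?_).resolve_right fun h =>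
    h0 (LinearMap.ker_eq_top.1 h)
  rw [LinearMap.mem_ker] at hx ⊢
  rw [hT.apply, hx, map_zero]

lemma range_eq_top (hT : Intertwines ρ σ T) (hσ : IsIrreducibleOn σ ⊤) (h0 : T ≠ 0) :
    LinearMap.range T = ⊤ := by
  refine (hσ.eq_bot_or_eq _ le_top ?_).resolve_left (mt LinearMap.range_eq_bot.1 h0)
  rintro a _ ⟨x, rfl⟩
  exact ⟨ρ a x, hT.apply a x⟩

lemma exists_eq_smul_id [FiniteDimensional ℂ V] {G : V →ₗ[ℂ] V} (hG : Intertwines ρ ρ G)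
    (hρ : IsIrreducibleOn ρ ⊤) : ∃ c : ℂ, G = c • LinearMap.id := by
  have : Nontrivial V := (Submodule.nontrivial_iff ℂ).1 ⟨⊤, ⊥, hρ.ne_bot⟩
  obtain ⟨c, hc⟩ := Module.End.exists_eigenvalue G
  refine ⟨c, sub_eq_zero.1 (by_contra fun h0 => ?_)⟩
  obtain ⟨x, hx, hx0⟩ := hc.exists_hasEigenvector
  refine hx0 ((Submodule.eq_bot_iff _).1 ((hG.sub (.smul .id c)).ker_eq_bot hρ h0) x ?_)
  rw [LinearMap.mem_ker, LinearMap.sub_apply, Module.End.mem_eigenspace_iff.1 hx]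
  simp

end Intertwines

end Irreducible

/-! ### The adjoint representation acting on a representation -/

section Hopf

variable {A V W X : Type*} [Ring A] [HopfAlgebra ℂ A] [AddCommGroup V] [Module ℂ V]
  [AddCommGroup W] [Module ℂ W] [AddCommGroup X] [Module ℂ X]

lemma map_ad (ρ : A →ₐ[ℂ] Module.End ℂ V) (a u : A) : ρ (ad A a u) = homRep ρ ρ a (ρ u) := by
  rw [ad, homRep, AlgHom.comp_apply, AlgHom.comp_apply]
  generalize Bialgebra.comulAlgHom ℂ A a = z
  induction z with
  | zero => simp
  | tmul x y =>
    change ρ (x * (u * HopfAlgebra.antipode ℂ y)) = ρ x * (ρ u * ρ (HopfAlgebra.antipode ℂ y))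
    rw [map_mul, map_mul]
  | add x y hx hy => simp only [map_add, LinearMap.add_apply, hx, hy]

/-- The linear map `a ⊗ a' ↦ a b S(a')`, which turns the coproduct of `a` into `ad_a b`. -/
def adTensor (b : A) : A ⊗[ℂ] A →ₗ[ℂ] A :=
  LinearMap.mul' ℂ A ∘ₗ TensorProduct.map (LinearMap.mulRight ℂ b) (HopfAlgebra.antipode ℂ)

@[simp] lemma adTensor_tmul (b x y : A) :
    adTensor b (x ⊗ₜ[ℂ] y) = x * b * HopfAlgebra.antipode ℂ y := rfl

lemma ad_apply (a b : A) : ad A a b = adTensor b (Coalgebra.comul a) := by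
  rw [ad, AlgHom.comp_apply, Bialgebra.comulAlgHom_apply]
  generalize Coalgebra.comul (R := ℂ) a = z
  induction z with
  | zero => simp
  | tmul x y => exact (mul_assoc x b _).symm
  | add x y hx hy => simp only [map_add, LinearMap.add_apply, hx, hy]

lemma flip_ad (b : A) : (ad A).toLinearMap.flip b = adTensor b ∘ₗ Coalgebra.comul :=
  LinearMap.ext fun a => ad_apply a b

/-- In Sweedler notation, `∑ a₍₁₎ b S(a₍₂₎) a₍₃₎ = a b`. -/
lemma mul_rTensor_ad_comul (a b : A) :
    LinearMap.mul' ℂ A (((ad A).toLinearMap.flip b).rTensor A (Coalgebra.comul a)) = a * b := by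
  have hassoc : ∀ x : A, ∀ w : A ⊗[ℂ] A,
      LinearMap.mul' ℂ A ((adTensor b).rTensor A ((TensorProduct.assoc ℂ A A A).symm (x ⊗ₜ w))) =
        x * b * LinearMap.mul' ℂ A ((HopfAlgebra.antipode ℂ).rTensor A w) := by
    intro x w
    induction w with
    | zero => simp
    | tmul y z => simp [mul_assoc]
    | add y z hy hz => simp only [TensorProduct.tmul_add, map_add, mul_add, hy, hz]
  have hcounit : ∀ w : A ⊗[ℂ] A,
      LinearMap.mul' ℂ A ((adTensor b).rTensor A ((TensorProduct.assoc ℂ A A A).symm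
        (Coalgebra.comul.lTensor A w))) =
      TensorProduct.rid ℂ A (Coalgebra.counit.lTensor A w) * b := by
    intro w
    induction w with
    | zero => simp
    | tmul x y =>
      rw [LinearMap.lTensor_tmul, hassoc, HopfAlgebra.mul_antipode_rTensor_comul_apply]
      simp [Algebra.algebraMap_eq_smul_one]
    | add y z hy hz => simp only [map_add, add_mul, hy, hz]
  rw [flip_ad, LinearMap.rTensor_comp_apply, ← Coalgebra.coassoc_symm_apply, hcounit,
    Coalgebra.lTensor_counit_comul]
  simp

/-- In Sweedler notation, `∑ a₍₁₎ x S(a₍₂₎) a₍₃₎ y S(b) = a x y S(b)`. -/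
lemma mul_map_ad_adTensor_assoc_comul (x y : A) (w : A ⊗[ℂ] A) :
    LinearMap.mul' ℂ A (TensorProduct.map ((ad A).toLinearMap.flip x) (adTensor y)
      (TensorProduct.assoc ℂ A A A (Coalgebra.comul.rTensor A w))) = adTensor (x * y) w := by
  have hassoc : ∀ w : A ⊗[ℂ] A, ∀ q : A,
      LinearMap.mul' ℂ A (TensorProduct.map ((ad A).toLinearMap.flip x) (adTensor y)
        (TensorProduct.assoc ℂ A A A (w ⊗ₜ q))) =
      LinearMap.mul' ℂ A (((ad A).toLinearMap.flip x).rTensor A w) * y *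
        HopfAlgebra.antipode ℂ q := by
    intro w q
    induction w with
    | zero => simp
    | tmul p r => simp [mul_assoc]
    | add p r hp hr => simp only [TensorProduct.add_tmul, map_add, add_mul, hp, hr]
  induction w with
  | zero => simp
  | tmul p q => rw [LinearMap.rTensor_tmul, hassoc, mul_rTensor_ad_comul]; simp [mul_assoc]
  | add p q hp hq => simp only [map_add, hp, hq]

/-- In Sweedler notation, `∑ a₍₁₎ x S(a₍₂₎) a₍₃₎ y S(a₍₄₎) = ∑ a₍₁₎ x y S(a₍₂₎)`. -/
lemma intertwines_mul : Intertwines (tensorRep (ad A) (ad A)) (ad A) (LinearMap.mul' ℂ A) := by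
  intro a
  refine TensorProduct.ext' fun x y => ?_
  have hcomul : ∀ w : A ⊗[ℂ] A, LinearMap.mul' ℂ A (Module.endTensorEndAlgHom (R := ℂ) (S := ℂ)
      (A := ℂ) (Algebra.TensorProduct.map (ad A) (ad A) w) (x ⊗ₜ y)) =
      LinearMap.mul' ℂ A (TensorProduct.map ((ad A).toLinearMap.flip x) (adTensor y)
        (TensorProduct.assoc ℂ A A A ((TensorProduct.assoc ℂ A A A).symm
          (Coalgebra.comul.lTensor A w)))) := by
    intro w
    induction w with
    | zero => simp
    | tmul p q => simp [Module.endTensorEndAlgHom_apply, ad_apply q y]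
    | add p q hp hq => simp only [map_add, LinearMap.add_apply, hp, hq]
  have h := hcomul (Coalgebra.comul a)
  rw [Coalgebra.coassoc_symm_apply, mul_map_ad_adTensor_assoc_comul, ← ad_apply] at h
  exact h

lemma intertwines_action (ρ : A →ₐ[ℂ] Module.End ℂ V) :
    Intertwines (tensorRep (ad A) ρ) ρ (TensorProduct.lift ρ.toLinearMap) := by
  intro a
  refine TensorProduct.ext' fun b x => ?_
  have key : ∀ w : A ⊗[ℂ] A, TensorProduct.lift ρ.toLinearMap
      (Module.endTensorEndAlgHom (R := ℂ) (S := ℂ) (A := ℂ)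
        (Algebra.TensorProduct.map (ad A) ρ w) (b ⊗ₜ x)) =
      ρ (LinearMap.mul' ℂ A (((ad A).toLinearMap.flip b).rTensor A w)) x := by
    intro w
    induction w with
    | zero => simp
    | tmul y z => simp [Module.endTensorEndAlgHom_apply]
    | add y z hy hz => simp only [map_add, LinearMap.add_apply, hy, hz]
  have h := key (Coalgebra.comul a)
  rw [mul_rTensor_ad_comul, map_mul] at h
  exact h

lemma Intertwines.rTensor {ρ : A →ₐ[ℂ] Module.End ℂ V} {σ : A →ₐ[ℂ] Module.End ℂ W}
    {T : V →ₗ[ℂ] W} (hT : Intertwines ρ σ T) (τ : A →ₐ[ℂ] Module.End ℂ X) :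
    Intertwines (tensorRep ρ τ) (tensorRep σ τ) (T.rTensor X) := by
  intro a
  simp only [tensorRep, AlgHom.comp_apply]
  generalize Bialgebra.comulAlgHom ℂ A a = z
  induction z with
  | zero => simp
  | tmul a b =>
    refine TensorProduct.ext' fun v x => ?_
    simp [Module.endTensorEndAlgHom_apply, hT.apply]
  | add a b ha hb => simp only [map_add, LinearMap.comp_add, LinearMap.add_comp, ha, hb]

end Hopf

end HopfRep

namespace QuantumSU2

variable {t : ℝˣ}

/-! ### `q`-numbers -/

lemma abs_coe_ne_one (ht : t ≠ 1) (ht' : t ≠ -1) : |(t : ℝ)| ≠ 1 := fun h =>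
  (eq_or_eq_neg_of_abs_eq h).elim (fun h => ht (Units.ext h)) fun h => ht' (Units.ext h)

lemma zpow_injective (ht : |(t : ℝ)| ≠ 1) : Function.Injective fun n : ℤ => (t : ℝ) ^ n := by
  intro a b h
  refine zpow_right_injective₀ (abs_pos.2 t.ne_zero) ht ?_
  simpa only [abs_zpow] using congrArg abs h

lemma zpow_two_sub_zpow_neg_two_ne_zero (ht : |(t : ℝ)| ≠ 1) :
    (t : ℝ) ^ (2 : ℤ) - (t : ℝ) ^ (-2 : ℤ) ≠ 0 :=
  sub_ne_zero.2 ((zpow_injective ht).ne (by norm_num))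

@[simp] lemma qnum_zero (t : ℝˣ) : qnum t 0 = 0 := by simp [qnum]

lemma qnum_add (t : ℝˣ) (a b : ℤ) :
    qnum t (a + b) = (t : ℝ) ^ (-(2 * b)) * qnum t a + (t : ℝ) ^ (2 * a) * qnum t b := by
  simp only [qnum, mul_div_assoc', ← add_div, mul_sub, ← zpow_add₀ t.ne_zero]
  ring_nf

lemma qnum_mul_sub_qnum_mul (t : ℝˣ) (N a : ℤ) :
    qnum t (a + 1) * qnum t (N - a) - qnum t a * qnum t (N - a + 1) = qnum t (N - 2 * a) := by
  rw [qnum_identity, inv_mul_eq_div, qnum]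

lemma qnum_pos (ht : |(t : ℝ)| ≠ 1) {n : ℤ} (hn : 0 < n) : 0 < qnum t n := by
  lift n to ℕ using hn.le
  refine lt_of_le_of_ne (qnum_nonneg t n) (div_ne_zero (sub_ne_zero.2 ?_) ?_).symm
  · exact (zpow_injective ht).ne (by omega)
  · exact zpow_two_sub_zpow_neg_two_ne_zero ht

@[simp] lemma qfact_zero (t : ℝˣ) : qfact t 0 = 1 := by simp [qfact]

lemma qfact_succ (t : ℝˣ) (n : ℕ) : qfact t (n + 1) = qfact t n * qnum t (n + 1) := by
  simp [qfact, Finset.prod_range_succ]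

lemma qfact_pos (ht : |(t : ℝ)| ≠ 1) (n : ℕ) : 0 < qfact t n :=
  Finset.prod_pos fun i _ => qnum_pos ht (by omega)

lemma qfact_add (t : ℝˣ) (a p : ℕ) :
    qfact t (a + p) = qfact t a * ∏ i ∈ Finset.range p, qnum t ((a + 1 : ℕ) + i) := by
  rw [qfact, qfact, Finset.prod_range_add]
  congr! 3
  push_cast
  ring

/-- The `q`-analogue `[a][a+1]⋯[a+p-1] / [p]!` of `Nat.multichoose a p`. -/
def qmultichoose (t : ℝˣ) (a p : ℕ) : ℝ := (∏ i ∈ Finset.range p, qnum t (a + i)) / qfact t p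

@[simp] lemma qmultichoose_zero_right (t : ℝˣ) (a : ℕ) : qmultichoose t a 0 = 1 := by
  simp [qmultichoose]

lemma qmultichoose_zero_succ (t : ℝˣ) (p : ℕ) : qmultichoose t 0 (p + 1) = 0 := by
  simp [qmultichoose, Finset.prod_range_succ']

lemma qmultichoose_succ_left (ht : |(t : ℝ)| ≠ 1) (a p : ℕ) :
    qmultichoose t (a + 1) p = qfact t (a + p) / (qfact t a * qfact t p) := by
  rw [qmultichoose, qfact_add, mul_div_mul_left _ _ (qfact_pos ht a).ne']

lemma qmultichoose_pos (ht : |(t : ℝ)| ≠ 1) (a p : ℕ) : 0 < qmultichoose t (a + 1) p := by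
  rw [qmultichoose_succ_left ht]
  exact div_pos (qfact_pos ht _) (mul_pos (qfact_pos ht _) (qfact_pos ht _))

lemma qmultichoose_succ_right_mul (ht : |(t : ℝ)| ≠ 1) (a p : ℕ) :
    qmultichoose t a (p + 1) * qnum t (p + 1) = qmultichoose t a p * qnum t (a + p) := by
  have hfact := (qfact_pos ht p).ne'
  have hnum := (qnum_pos ht (n := p + 1) (by omega)).ne'
  rw [qmultichoose, qmultichoose, Finset.prod_range_succ, qfact_succ]
  field_simp

lemma qmultichoose_succ_left_mul (t : ℝˣ) (a p : ℕ) :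
    qmultichoose t (a + 1) p * qnum t a = qmultichoose t a p * qnum t (a + p) := by
  have hprod := (Finset.prod_range_succ' (fun i : ℕ => qnum t (a + i)) p).symm.trans
    (Finset.prod_range_succ _ p)
  rw [qmultichoose, qmultichoose, div_mul_eq_mul_div, div_mul_eq_mul_div, ← hprod]
  congr! 4 with i
  push_cast
  ring

/-- The `q`-Pascal rule, multiplied by a power of `t` for which the exponents in the induction for
the `q`-Vandermonde identity match. -/
lemma qmultichoose_succ_succ (ht : |(t : ℝ)| ≠ 1) (c a p : ℕ) :
    (t : ℝ) ^ (2 * (c + 1) * (p + 1)) * qmultichoose t (a + 1) (p + 1) =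
      (t : ℝ) ^ (2 * c * (p + 1)) * qmultichoose t a (p + 1) +
        (t : ℝ) ^ (2 * (a + c + 1)) * ((t : ℝ) ^ (2 * (c + 1) * p) * qmultichoose t (a + 1) p) := by
  have hp := (qnum_pos ht (n := p + 1) (by omega)).ne'
  have hadd : (t : ℝ) ^ (2 * (p + 1)) * qnum t ((a + 1 : ℕ) + p) =
      qnum t a + (t : ℝ) ^ (2 * (a + p + 1)) * qnum t (p + 1) := by
    rw [show ((a + 1 : ℕ) : ℤ) + p = a + (p + 1) by push_cast; ring, qnum_add, mul_add,
      ← mul_assoc, ← mul_assoc, ← zpow_natCast, ← zpow_natCast, ← zpow_add₀ t.ne_zero,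
      ← zpow_add₀ t.ne_zero]
    push_cast
    ring_nf
    simp
  have hright := qmultichoose_succ_right_mul ht (a + 1) p
  have hright' := qmultichoose_succ_right_mul ht a p
  have hleft := qmultichoose_succ_left_mul t a p
  refine mul_right_cancel₀ hp ?_
  linear_combination (t : ℝ) ^ (2 * (c + 1) * (p + 1)) * hright -
    (t : ℝ) ^ (2 * c * (p + 1)) * (hright' - hleft) +
    (t : ℝ) ^ (2 * c * (p + 1)) * qmultichoose t (a + 1) p * hadd

lemma qmultichoose_vandermonde (ht : |(t : ℝ)| ≠ 1) (a b s : ℕ) :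
    ∑ x ∈ Finset.HasAntidiagonal.antidiagonal s,
        (t : ℝ) ^ (2 * (a + b) * x.1) * (qmultichoose t a x.1 * qmultichoose t b x.2) =
      (t : ℝ) ^ (2 * a * s) * qmultichoose t (a + b) s := by
  induction s generalizing a with
  | zero => simp
  | succ s ihs =>
    induction a with
    | zero =>
      rw [Finset.Nat.sum_antidiagonal_succ]
      simp [qmultichoose_zero_succ]
    | succ a iha =>
      have hpascal : ∀ x : ℕ × ℕ,
          (t : ℝ) ^ (2 * (a + 1 + b) * (x.1 + 1)) *
            (qmultichoose t (a + 1) (x.1 + 1) * qmultichoose t b x.2) =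
          (t : ℝ) ^ (2 * (a + b) * (x.1 + 1)) *
            (qmultichoose t a (x.1 + 1) * qmultichoose t b x.2) +
          (t : ℝ) ^ (2 * (a + (a + b) + 1)) * ((t : ℝ) ^ (2 * (a + 1 + b) * x.1) *
            (qmultichoose t (a + 1) x.1 * qmultichoose t b x.2)) := by
        intro x
        rw [add_right_comm a 1 b]
        linear_combination qmultichoose t b x.2 * qmultichoose_succ_succ ht (a + b) a x.1
      rw [Finset.Nat.sum_antidiagonal_succ] at iha ⊢
      simp only [hpascal, Finset.sum_add_distrib, ← Finset.mul_sum, ihs]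
      simp only [mul_zero, pow_zero, one_mul, qmultichoose_zero_right] at iha ⊢
      rw [← add_assoc, iha, add_right_comm a 1 b, qmultichoose_succ_succ ht a (a + b) s]
      ring

end QuantumSU2

namespace QuantumSU2

open HopfRep

/-! ### Representations of `U t` -/

variable {t : ℝˣ} {X Y : Type*} [AddCommGroup X] [Module ℂ X] [AddCommGroup Y] [Module ℂ Y]
  {ρ : U t →ₐ[ℂ] Module.End ℂ X} {σ : U t →ₐ[ℂ] Module.End ℂ Y}

lemma intertwines_of_generators {T : X →ₗ[ℂ] Y} (he : T ∘ₗ ρ (e t) = σ (e t) ∘ₗ T)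
    (hf : T ∘ₗ ρ (f t) = σ (f t) ∘ₗ T) (hk : T ∘ₗ ρ (k t) = σ (k t) ∘ₗ T) :
    Intertwines ρ σ T := by
  intro a
  induction a using U_induction with
  | hc c => ext x; simp [Algebra.algebraMap_eq_smul_one]
  | he => exact he
  | hf => exact hf
  | hk => exact hk
  | hk' =>
    calc T ∘ₗ ρ (kinv t) = (σ (kinv t) * σ (k t)) ∘ₗ T ∘ₗ ρ (kinv t) := by
          rw [← map_mul, kinv_mul_k, map_one, Module.End.one_eq_id, LinearMap.id_comp]
      _ = σ (kinv t) ∘ₗ (σ (k t) ∘ₗ T) ∘ₗ ρ (kinv t) := rfl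
      _ = σ (kinv t) ∘ₗ T ∘ₗ (ρ (k t) * ρ (kinv t)) := by rw [← hk]; rfl
      _ = σ (kinv t) ∘ₗ T := by
          rw [← map_mul, k_mul_kinv, map_one, Module.End.one_eq_id, LinearMap.comp_id]
  | hadd a b ha hb => rw [map_add, map_add, LinearMap.comp_add, LinearMap.add_comp, ha, hb]
  | hmul a b ha hb =>
    rw [map_mul, map_mul, Module.End.mul_eq_comp, Module.End.mul_eq_comp, ← LinearMap.comp_assoc,
      ha, LinearMap.comp_assoc, hb, LinearMap.comp_assoc]

lemma tensorRep_e (ρ : U t →ₐ[ℂ] Module.End ℂ X) (σ : U t →ₐ[ℂ] Module.End ℂ Y) :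
    tensorRep ρ σ (e t) =
      TensorProduct.map (ρ (e t)) (σ (kinv t)) + TensorProduct.map (ρ (k t)) (σ (e t)) := by
  simp [tensorRep, comul_eq, Δ, Module.endTensorEndAlgHom_apply,
    TensorProduct.AlgebraTensorModule.map_eq]

lemma tensorRep_f (ρ : U t →ₐ[ℂ] Module.End ℂ X) (σ : U t →ₐ[ℂ] Module.End ℂ Y) :
    tensorRep ρ σ (f t) =
      TensorProduct.map (ρ (f t)) (σ (kinv t)) + TensorProduct.map (ρ (k t)) (σ (f t)) := by
  simp [tensorRep, comul_eq, Δ, Module.endTensorEndAlgHom_apply,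
    TensorProduct.AlgebraTensorModule.map_eq]

lemma tensorRep_k (ρ : U t →ₐ[ℂ] Module.End ℂ X) (σ : U t →ₐ[ℂ] Module.End ℂ Y) :
    tensorRep ρ σ (k t) = TensorProduct.map (ρ (k t)) (σ (k t)) := by
  simp [tensorRep, comul_eq, Δ, Module.endTensorEndAlgHom_apply,
    TensorProduct.AlgebraTensorModule.map_eq]

lemma map_apply_eq_zero_of_mul_eq_smul {a b : U t} {c : ℂ} (h : b * a = c • (a * b)) (hc : c ≠ 0)
    {x : X} (hx : ρ a x = 0) : ρ a (ρ b x) = 0 := by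
  have h' := LinearMap.congr_fun (congrArg ρ h) x
  rw [map_mul, map_smul, map_mul, Module.End.mul_apply, hx, map_zero] at h'
  exact (smul_eq_zero.1 h'.symm).resolve_left hc

lemma tensorRep_f_pow_tmul_eq_zero {n a b : ℕ} {x : X} {y : Y} (hab : a + b ≤ n + 1)
    (hx : ρ (f t ^ a) x = 0) (hy : σ (f t ^ b) y = 0) :
    tensorRep ρ σ (f t ^ n) (x ⊗ₜ y) = 0 := by
  induction n generalizing a b x y with
  | zero =>
    rcases (by omega : a = 0 ∨ b = 0) with rfl | rfl
    · simp_all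
    · simp_all
  | succ n ih =>
    rcases a with _ | a
    · simp_all
    rcases b with _ | b
    · simp_all
    have hkx := map_apply_eq_zero_of_mul_eq_smul (mul_pow_of_mul_eq_smul k_mul_f (a + 1))
      (pow_ne_zero _ (zpow_ne_zero _ (t_ne t))) hx
    have hky := map_apply_eq_zero_of_mul_eq_smul (mul_pow_of_mul_eq_smul kinv_mul_f (b + 1))
      (pow_ne_zero _ (zpow_ne_zero _ (t_ne t))) hy
    rw [pow_succ, map_mul, Module.End.mul_apply] at hx hy
    rw [pow_succ, map_mul, Module.End.mul_apply, tensorRep_f, LinearMap.add_apply,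
      TensorProduct.map_tmul, TensorProduct.map_tmul, map_add, ih (by omega) hx hky,
      ih (by omega) hkx hy, add_zero]

/-! ### Weight vectors -/

lemma map_kinv_of_map_k {x : X} {M : ℤ} (h : ρ (k t) x = ((t : ℝ) : ℂ) ^ M • x) :
    ρ (kinv t) x = ((t : ℝ) : ℂ) ^ (-M) • x := by
  rw [zpow_neg, eq_inv_smul_iff₀ (zpow_ne_zero _ (t_ne t)), ← map_smul, ← h,
    ← Module.End.mul_apply, ← map_mul, kinv_mul_k, map_one, Module.End.one_apply]

lemma map_k_map_f {x : X} {M : ℤ} (h : ρ (k t) x = ((t : ℝ) : ℂ) ^ M • x) :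
    ρ (k t) (ρ (f t) x) = ((t : ℝ) : ℂ) ^ (M - 2) • ρ (f t) x := by
  rw [← Module.End.mul_apply, ← map_mul, k_mul_f, map_smul, map_mul, LinearMap.smul_apply,
    Module.End.mul_apply, h, map_smul, smul_smul, ← zpow_add₀ (t_ne t), neg_add_eq_sub]

lemma map_e_map_f {x : X} {M : ℤ} (h : ρ (k t) x = ((t : ℝ) : ℂ) ^ M • x) :
    ρ (e t) (ρ (f t) x) = ρ (f t) (ρ (e t) x) + (qnum t M : ℂ) • x := by
  have hcomm := LinearMap.congr_fun (congrArg ρ (e_mul_f (t := t))) x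
  simp only [map_sub, map_mul, map_smul, pow_two, LinearMap.sub_apply, Module.End.mul_apply,
    LinearMap.smul_apply, h, map_kinv_of_map_k h, smul_smul, ← sub_smul,
    ← zpow_add₀ (t_ne t)] at hcomm
  rw [sub_eq_iff_eq_add'.1 hcomm, qnum]
  push_cast
  ring_nf

/-- A highest weight vector of weight `t ^ M`; the zero vector is allowed. -/
structure IsHighestWeightVector (ρ : U t →ₐ[ℂ] Module.End ℂ X) (M : ℤ) (v : X) : Prop where
  map_e : ρ (e t) v = 0
  map_k : ρ (k t) v = ((t : ℝ) : ℂ) ^ M • v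

namespace IsHighestWeightVector

variable {v : X} {w : Y} {M M' : ℤ}

lemma smul (hv : IsHighestWeightVector ρ M v) (c : ℂ) : IsHighestWeightVector ρ M (c • v) where
  map_e := by rw [map_smul, hv.map_e, smul_zero]
  map_k := by rw [map_smul, hv.map_k, smul_comm]

lemma map (hv : IsHighestWeightVector ρ M v) {T : X →ₗ[ℂ] Y} (hT : Intertwines ρ σ T) :
    IsHighestWeightVector σ M (T v) where
  map_e := by rw [← hT.apply, hv.map_e, map_zero]
  map_k := by rw [← hT.apply, hv.map_k, map_smul]

lemma tmul (hv : IsHighestWeightVector ρ M v) (hw : IsHighestWeightVector σ M' w) :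
    IsHighestWeightVector (tensorRep ρ σ) (M + M') (v ⊗ₜ w) where
  map_e := by simp [tensorRep_e, hv.map_e, hw.map_e]
  map_k := by
    rw [tensorRep_k, TensorProduct.map_tmul, hv.map_k, hw.map_k, TensorProduct.smul_tmul_smul,
      zpow_add₀ (t_ne t)]

lemma map_k_f_pow (hv : IsHighestWeightVector ρ M v) (s : ℕ) :
    ρ (k t) (ρ (f t ^ s) v) = ((t : ℝ) : ℂ) ^ (M - 2 * s) • ρ (f t ^ s) v := by
  induction s with
  | zero => simpa using hv.map_k
  | succ s ih =>
    rw [pow_succ', map_mul, Module.End.mul_apply, map_k_map_f ih]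
    push_cast
    ring_nf

lemma map_e_f_pow_succ (hv : IsHighestWeightVector ρ M v) (s : ℕ) :
    ρ (e t) (ρ (f t ^ (s + 1)) v) =
      ((qnum t (s + 1) * qnum t (M - s) : ℝ) : ℂ) • ρ (f t ^ s) v := by
  have hstep (s : ℕ) : ρ (e t) (ρ (f t ^ (s + 1)) v) = ρ (f t) (ρ (e t) (ρ (f t ^ s) v)) +
      ((qnum t (s + 1) * qnum t (M - s) - qnum t s * qnum t (M - s + 1) : ℝ) : ℂ) •
        ρ (f t ^ s) v := by
    rw [pow_succ', map_mul, Module.End.mul_apply, map_e_map_f (hv.map_k_f_pow s),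
      qnum_mul_sub_qnum_mul]
  induction s with
  | zero =>
    rw [hstep]
    simp [hv.map_e]
  | succ s ih =>
    rw [hstep, ih, map_smul, ← Module.End.mul_apply, ← map_mul, ← pow_succ', ← add_smul,
      ← Complex.ofReal_add]
    push_cast
    ring_nf

end IsHighestWeightVector

end QuantumSU2

namespace QuantumSU2

open HopfRep

variable {t : ℝˣ}

/-! ### The representations `V^j` -/

/-- The weight basis vector `wt N s`, extended by zero to all natural indices `s`, so that the
ladder relations hold without boundary cases. -/
def wv (N s : ℕ) : V N := fun i => if (i : ℕ) = s then 1 else 0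

lemma wt_eq_wv (N : ℕ) (s : Fin (N + 1)) : wt N s = wv N s := by
  ext i
  simp [wt, wv, Pi.single_apply, Fin.ext_iff]

lemma wv_of_lt {N s : ℕ} (h : N < s) : wv N s = 0 := by
  ext i
  simp [wv, (i.is_le.trans_lt h).ne]

lemma wv_ne_zero {N s : ℕ} (h : s ≤ N) : wv N s ≠ 0 := fun h0 => by
  simpa [wv] using congrFun h0 ⟨s, Nat.lt_succ_of_le h⟩

lemma eq_sum_wv {N : ℕ} (x : V N) : x = ∑ i : Fin (N + 1), x i • wv N i := by
  simp only [← wt_eq_wv, wt]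
  simp [Pi.single_apply, funext_iff]

lemma linearMap_ext_wv {N : ℕ} {X : Type*} [AddCommGroup X] [Module ℂ X] {T T' : V N →ₗ[ℂ] X}
    (h : ∀ s ≤ N, T (wv N s) = T' (wv N s)) : T = T' := by
  refine LinearMap.ext fun x => ?_
  rw [eq_sum_wv x, map_sum, map_sum]
  refine Finset.sum_congr rfl fun i _ => ?_
  rw [map_smul, map_smul, h i i.is_le]

/-- The scalar `([N - b][b + 1])^{1/2}` by which `e` and `f` connect `wv N b` and `wv N (b + 1)`. -/
def ladder (t : ℝˣ) (N b : ℕ) : ℝ := √(qnum t (N - b) * qnum t (b + 1))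

lemma ladder_self (t : ℝˣ) (N : ℕ) : ladder t N N = 0 := by simp [ladder]

lemma ladder_sq {N b : ℕ} (h : b ≤ N) : ladder t N b ^ 2 = qnum t (N - b) * qnum t (b + 1) := by
  rw [ladder, Real.sq_sqrt]
  exact_mod_cast mul_nonneg (Nat.cast_sub (R := ℤ) h ▸ qnum_nonneg t (N - b))
    (qnum_nonneg t (b + 1))

lemma ladder_pos (ht : |(t : ℝ)| ≠ 1) {N b : ℕ} (h : b < N) : 0 < ladder t N b :=
  Real.sqrt_pos.2 (mul_pos (qnum_pos ht (by omega)) (qnum_pos ht (by omega)))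

lemma eMat_apply (t : ℝˣ) (N : ℕ) (a b : Fin (N + 1)) :
    eMat t N a b = if (a : ℕ) + 1 = b then (ladder t N a : ℂ) else 0 := by
  rw [eMat, Matrix.of_apply]
  refine ite_congr rfl (fun h => ?_) fun _ => rfl
  rw [← h, mul_comm, ladder]
  push_cast
  ring_nf

lemma mulVec_wv {N s : ℕ} (M : Matrix (Fin (N + 1)) (Fin (N + 1)) ℂ) (hs : s ≤ N) :
    M.mulVec (wv N s) = fun i => M i ⟨s, Nat.lt_succ_of_le hs⟩ := by
  rw [← wt_eq_wv N ⟨s, Nat.lt_succ_of_le hs⟩, wt]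
  ext i
  simp

lemma irrep_e_wv_zero (t : ℝˣ) (N : ℕ) : irrep t N (e t) (wv N 0) = 0 := by
  ext i
  simp [irrep, mulVec_wv, eMat_apply]

lemma irrep_e_wv_succ (t : ℝˣ) (N s : ℕ) :
    irrep t N (e t) (wv N (s + 1)) = (ladder t N s : ℂ) • wv N s := by
  rcases lt_trichotomy s N with h | rfl | h
  · ext i
    simp only [irrep, AlgHom.comp_apply, lift_e]
    change (eMat t N).mulVec _ i = _
    rw [mulVec_wv _ h]
    simp only [eMat_apply, wv, Pi.smul_apply, smul_eq_mul, Nat.succ_eq_add_one, add_left_inj]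
    split_ifs with hi
    · rw [hi, mul_one]
    · rw [mul_zero]
  · simp [wv_of_lt, ladder_self]
  · simp [wv_of_lt h, wv_of_lt (h.trans s.lt_succ_self)]

lemma irrep_f_wv (t : ℝˣ) (N s : ℕ) :
    irrep t N (f t) (wv N s) = (ladder t N s : ℂ) • wv N (s + 1) := by
  rcases le_or_gt s N with h | h
  · ext i
    simp only [irrep, AlgHom.comp_apply, lift_f]
    change (fMat t N).mulVec _ i = _
    rw [mulVec_wv _ h]
    simp [fMat, ladder, wv]
  · simp [wv_of_lt h, wv_of_lt (h.trans s.lt_succ_self)]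

lemma irrep_k_apply_apply (t : ℝˣ) {N : ℕ} (x : V N) (i : Fin (N + 1)) :
    irrep t N (k t) x i = ((t : ℝ) : ℂ) ^ ((N : ℤ) - 2 * i) * x i := by
  simp [irrep, kMat, Matrix.mulVec_diagonal]

lemma irrep_k_wv (t : ℝˣ) (N s : ℕ) :
    irrep t N (k t) (wv N s) = ((t : ℝ) : ℂ) ^ ((N : ℤ) - 2 * s) • wv N s := by
  ext i
  rw [irrep_k_apply_apply, Pi.smul_apply, smul_eq_mul, wv]
  split_ifs with h
  · rw [h]
  · rw [mul_zero, mul_zero]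

lemma irrep_f_apply_zero (t : ℝˣ) {N : ℕ} (x : V N) : irrep t N (f t) x 0 = 0 := by
  simp [irrep, fMat, Matrix.mulVec, dotProduct]

/-- The scalar relating `f ^ s` applied to the highest weight vector to `wv N s`. -/
def ladderProd (t : ℝˣ) (N s : ℕ) : ℝ := ∏ b ∈ Finset.range s, ladder t N b

@[simp] lemma ladderProd_zero (t : ℝˣ) (N : ℕ) : ladderProd t N 0 = 1 := by simp [ladderProd]

lemma ladderProd_succ (t : ℝˣ) (N s : ℕ) :
    ladderProd t N (s + 1) = ladderProd t N s * ladder t N s := Finset.prod_range_succ _ _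

lemma ladderProd_pos (ht : |(t : ℝ)| ≠ 1) {N s : ℕ} (h : s ≤ N) : 0 < ladderProd t N s :=
  Finset.prod_pos fun _ hb => ladder_pos ht ((Finset.mem_range.1 hb).trans_le h)

lemma ladderProd_sq {N s : ℕ} (h : s ≤ N) :
    ladderProd t N s ^ 2 * qfact t (N - s) = qfact t N * qfact t s := by
  induction s with
  | zero => simp
  | succ s ih =>
    have hsub : N - s = N - (s + 1) + 1 := by omega
    have hq := qfact_succ t (N - (s + 1))
    rw [← hsub, Nat.cast_sub h, Nat.cast_succ, sub_add_eq_sub_sub, sub_add_cancel] at hq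
    rw [ladderProd_succ, mul_pow, ladder_sq (by omega), qfact_succ t s, ← mul_assoc (qfact t N),
      ← ih (by omega), hq]
    ring

lemma inv_ladderProd_eq_sqrt (ht : |(t : ℝ)| ≠ 1) {N s : ℕ} (h : s ≤ N) :
    (ladderProd t N s)⁻¹ = √(qfact t (N - s) / (qfact t N * qfact t s)) := by
  rw [← ladderProd_sq h, div_mul_cancel_right₀ (qfact_pos ht _).ne', Real.sqrt_inv,
    Real.sqrt_sq (ladderProd_pos ht h).le]

lemma irrep_f_pow_wv_zero (t : ℝˣ) (N s : ℕ) :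
    irrep t N (f t ^ s) (wv N 0) = (ladderProd t N s : ℂ) • wv N s := by
  induction s with
  | zero => simp
  | succ s ih =>
    rw [pow_succ', map_mul, Module.End.mul_apply, ih, map_smul, irrep_f_wv, smul_smul,
      ladderProd_succ, Complex.ofReal_mul]

lemma irrep_e_pow_wv (t : ℝˣ) (N s : ℕ) :
    irrep t N (e t ^ s) (wv N s) = (ladderProd t N s : ℂ) • wv N 0 := by
  induction s with
  | zero => simp
  | succ s ih =>
    rw [pow_succ, map_mul, Module.End.mul_apply, irrep_e_wv_succ, map_smul, ih, smul_smul,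
      ladderProd_succ, mul_comm, Complex.ofReal_mul]

lemma irrep_e_pow_wv_of_lt (t : ℝˣ) (N : ℕ) {i s : ℕ} (h : i < s) :
    irrep t N (e t ^ s) (wv N i) = 0 := by
  obtain ⟨r, rfl⟩ : ∃ r, s = r + 1 + i := ⟨s - i - 1, by omega⟩
  rw [pow_add, map_mul, Module.End.mul_apply, irrep_e_pow_wv, map_smul, pow_succ, map_mul,
    Module.End.mul_apply, irrep_e_wv_zero, map_zero, smul_zero]

lemma irrep_e_pow_apply (t : ℝˣ) {N : ℕ} {x : V N} {j : Fin (N + 1)} (hx : ∀ i > j, x i = 0) :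
    irrep t N (e t ^ (j : ℕ)) x = (x j * ladderProd t N j) • wv N 0 := by
  conv_lhs => rw [eq_sum_wv x, map_sum]
  rw [Finset.sum_eq_single j, map_smul, irrep_e_pow_wv, smul_smul]
  · intro i _ hij
    rcases hij.lt_or_gt with h | h
    · rw [map_smul, irrep_e_pow_wv_of_lt t N h, smul_zero]
    · rw [hx i h, zero_smul, map_zero]
  · simp

lemma eq_top_of_wv_zero_mem (ht : |(t : ℝ)| ≠ 1) {N : ℕ} {S : Submodule ℂ (V N)}
    (hS : ∀ a, ∀ x ∈ S, irrep t N a x ∈ S) (h0 : wv N 0 ∈ S) : S = ⊤ := by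
  refine Submodule.eq_top_iff'.2 fun x => ?_
  rw [eq_sum_wv x]
  refine S.sum_mem fun i _ => S.smul_mem _ ?_
  have h := hS (f t ^ (i : ℕ)) _ h0
  rw [irrep_f_pow_wv_zero] at h
  exact (S.smul_mem_iff (by exact_mod_cast (ladderProd_pos ht i.is_le).ne')).1 h

lemma isIrreducibleOn_irrep (ht : |(t : ℝ)| ≠ 1) (N : ℕ) : IsIrreducibleOn (irrep t N) ⊤ where
  ne_bot := top_ne_bot
  invariant _ _ _ := Submodule.mem_top
  eq_bot_or_eq S _ hS := by
    refine or_iff_not_imp_left.2 fun hbot => eq_top_of_wv_zero_mem ht hS ?_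
    obtain ⟨x, hxS, hx0⟩ := S.ne_bot_iff.1 hbot
    obtain ⟨i, hi⟩ := Function.ne_iff.1 hx0
    obtain ⟨j, hj, hmax⟩ := (Finset.univ.filter fun i => x i ≠ 0).exists_max_image id
      ⟨i, by simpa using hi⟩
    have hx : ∀ i > j, x i = 0 := fun i hij => by_contra fun h =>
      hij.not_ge (hmax i (by simpa using h))
    have h := hS (e t ^ (j : ℕ)) x hxS
    rw [irrep_e_pow_apply t hx] at h
    refine (S.smul_mem_iff (mul_ne_zero (by simpa using hj) ?_)).1 h
    exact_mod_cast (ladderProd_pos ht j.is_le).ne'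

/-! ### Highest weight modules -/

section HighestWeight

variable {X : Type*} [AddCommGroup X] [Module ℂ X] {ρ : U t →ₐ[ℂ] Module.End ℂ X} {M : ℕ} {v : X}

/-- The linear map from `V M` that sends the highest weight vector to `v` and commutes with the
powers of `f` that do not annihilate the highest weight vector. -/
def hwMap (ρ : U t →ₐ[ℂ] Module.End ℂ X) (M : ℕ) (v : X) : V M →ₗ[ℂ] X :=
  (Pi.basisFun ℂ (Fin (M + 1))).constr ℂ fun s => (ladderProd t M s : ℂ)⁻¹ • ρ (f t ^ (s : ℕ)) v

lemma hwMap_wt (ρ : U t →ₐ[ℂ] Module.End ℂ X) (v : X) (s : Fin (M + 1)) :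
    hwMap ρ M v (wt M s) = (ladderProd t M s : ℂ)⁻¹ • ρ (f t ^ (s : ℕ)) v := by
  rw [hwMap, wt, ← Pi.basisFun_apply, Module.Basis.constr_basis]

lemma hwMap_wv (ρ : U t →ₐ[ℂ] Module.End ℂ X) (v : X) {s : ℕ} (hs : s ≤ M) :
    hwMap ρ M v (wv M s) = (ladderProd t M s : ℂ)⁻¹ • ρ (f t ^ s) v := by
  rw [← wt_eq_wv M ⟨s, Nat.lt_succ_of_le hs⟩, hwMap_wt]

lemma hwMap_wv_zero (ρ : U t →ₐ[ℂ] Module.End ℂ X) (M : ℕ) (v : X) :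
    hwMap ρ M v (wv M 0) = v := by simp [hwMap_wv]

lemma inv_ladderProd_eq (ht : |(t : ℝ)| ≠ 1) {N s : ℕ} (h : s < N) :
    (ladderProd t N s : ℂ)⁻¹ = ladder t N s * (ladderProd t N (s + 1) : ℂ)⁻¹ := by
  have hl : (ladder t N s : ℂ) ≠ 0 := by exact_mod_cast (ladder_pos ht h).ne'
  rw [ladderProd_succ, Complex.ofReal_mul, mul_inv_rev, mul_inv_cancel_left₀ hl]

lemma IsHighestWeightVector.intertwines_hwMap (hv : IsHighestWeightVector ρ M v)
    (ht : |(t : ℝ)| ≠ 1) (hf : ρ (f t ^ (M + 1)) v = 0) :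
    Intertwines (irrep t M) ρ (hwMap ρ M v) := by
  refine intertwines_of_generators (linearMap_ext_wv fun s hs => ?_)
    (linearMap_ext_wv fun s hs => ?_) (linearMap_ext_wv fun s hs => ?_) <;>
    simp only [LinearMap.comp_apply]
  · rcases s with _ | s
    · rw [irrep_e_wv_zero, map_zero, hwMap_wv_zero, hv.map_e]
    · rw [irrep_e_wv_succ, map_smul, hwMap_wv ρ v (by omega), hwMap_wv ρ v hs, map_smul,
        hv.map_e_f_pow_succ, mul_comm (qnum t _), ← ladder_sq (by omega), inv_ladderProd_eq ht hs,
        smul_smul, smul_smul]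
      push_cast
      ring_nf
  · rw [irrep_f_wv, map_smul, hwMap_wv ρ v hs, map_smul, ← Module.End.mul_apply, ← map_mul,
      ← pow_succ']
    rcases hs.lt_or_eq with h | rfl
    · rw [hwMap_wv ρ v h, smul_smul, inv_ladderProd_eq ht h]
    · rw [hf, ladder_self, Complex.ofReal_zero, zero_smul, smul_zero]
  · rw [irrep_k_wv, map_smul, hwMap_wv ρ v hs, map_smul, hv.map_k_f_pow, smul_comm]

end HighestWeight

end QuantumSU2

namespace QuantumSU2

open HopfRep

variable {t : ℝˣ}

/-! ### The adjoint representation of `U_t(su(2))` -/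

lemma ad_e_apply (x : U t) :
    ad (U t) (e t) x = e t * x * k t - ((t : ℝ) : ℂ) ^ (-2 : ℤ) • (k t * x * e t) := by
  have h : HopfAlgebra.antipode ℂ (A := U t) = antipode t := rfl
  simp [ad, comul_eq, Δ, h, antipode_e, antipode_kinv, mul_assoc, sub_eq_add_neg]

lemma ad_f_apply (x : U t) :
    ad (U t) (f t) x = f t * x * k t - ((t : ℝ) : ℂ) ^ (2 : ℤ) • (k t * x * f t) := by
  have h : HopfAlgebra.antipode ℂ (A := U t) = antipode t := rfl
  simp [ad, comul_eq, Δ, h, antipode_f, antipode_kinv, mul_assoc, sub_eq_add_neg]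

lemma ad_k_apply (x : U t) : ad (U t) (k t) x = k t * x * kinv t := by
  have h : HopfAlgebra.antipode ℂ (A := U t) = antipode t := rfl
  simp [ad, comul_eq, Δ, h, antipode_k, mul_assoc]

lemma isHighestWeightVector_one : IsHighestWeightVector (ad (U t)) 0 1 where
  map_e := by simp [ad_e_apply, k_mul_e, smul_smul, t_ne t]
  map_k := by simp [ad_k_apply, k_mul_kinv]

lemma isHighestWeightVector_e_mul_kinv : IsHighestWeightVector (ad (U t)) 2 (e t * kinv t) where
  map_e := by
    rw [ad_e_apply, ← mul_assoc (k t), k_mul_e, smul_mul_assoc, smul_mul_assoc, smul_smul,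
      ← zpow_add₀ (t_ne t), mul_assoc (e t) (k t), k_mul_kinv, ← mul_assoc (e t), mul_assoc,
      kinv_mul_k]
    simp
  map_k := by
    rw [ad_k_apply, ← mul_assoc, k_mul_e, smul_mul_assoc, smul_mul_assoc, mul_assoc (e t) (k t),
      k_mul_kinv, mul_one]

lemma ad_f_e_mul_kinv :
    ad (U t) (f t) (e t * kinv t) = f t * e t - ((t : ℝ) : ℂ) ^ (4 : ℤ) • (e t * f t) := by
  rw [ad_f_apply, ← mul_assoc (k t), k_mul_e, smul_mul_assoc, smul_mul_assoc, smul_smul,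
    ← zpow_add₀ (t_ne t), mul_assoc (e t) (k t), k_mul_kinv, ← mul_assoc (f t), mul_assoc,
    kinv_mul_k, mul_one, mul_one]
  rfl

lemma ad_f_f_mul_e : ad (U t) (f t) (f t * e t) = -(f t * k t * (e t * f t - f t * e t)) := by
  have hkf (z : U t) : k t * (f t * z) = ((t : ℝ) : ℂ) ^ (-2 : ℤ) • (f t * (k t * z)) := by
    rw [← mul_assoc, k_mul_f, smul_mul_assoc, mul_assoc]
  have hke (z : U t) : k t * (e t * z) = ((t : ℝ) : ℂ) ^ (2 : ℤ) • (e t * (k t * z)) := by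
    rw [← mul_assoc, k_mul_e, smul_mul_assoc, mul_assoc]
  simp only [ad_f_apply, mul_sub, mul_assoc, hkf, hke, k_mul_e, k_mul_f, mul_smul_comm, smul_smul,
    t_zpow, mul_comm (((t : ℝ) : ℂ) ^ (-2 : ℤ)), one_smul, neg_sub]

lemma ad_f_e_mul_f :
    ad (U t) (f t) (e t * f t) =
      -(((t : ℝ) : ℂ) ^ (2 : ℤ) • (k t * (e t * f t - f t * e t) * f t)) := by
  have hfk : f t * k t = ((t : ℝ) : ℂ) ^ (2 : ℤ) • (k t * f t) := by
    rw [k_mul_f, smul_smul, t_zpow, one_smul]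
  have hfek : f t * e t * k t = k t * (f t * e t) := by
    rw [← mul_assoc, k_mul_f, smul_mul_assoc, mul_assoc (f t) (k t), k_mul_e, mul_smul_comm,
      smul_smul, mul_comm, t_zpow, one_smul, mul_assoc]
  rw [ad_f_apply, ← mul_assoc, mul_assoc (f t * e t), hfk, mul_smul_comm, ← mul_assoc, hfek,
    ← smul_sub, ← smul_neg, ← sub_mul, ← mul_sub, ← neg_mul, ← mul_neg, neg_sub]

lemma ad_f_f_mul_kinv : ad (U t) (f t) (f t * kinv t) = 0 := by
  rw [ad_f_apply, ← mul_assoc (k t), k_mul_f, smul_mul_assoc, smul_mul_assoc, smul_smul,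
    ← zpow_add₀ (t_ne t), mul_assoc (f t) (k t), k_mul_kinv, ← mul_assoc (f t), mul_assoc,
    kinv_mul_k]
  simp

lemma ad_f_ad_f_e_mul_kinv : ∃ c : ℂ,
    ad (U t) (f t) (ad (U t) (f t) (e t * kinv t)) = c • (f t * kinv t) := by
  set d := (((t : ℝ) : ℂ) ^ (2 : ℤ) - ((t : ℝ) : ℂ) ^ (-2 : ℤ))⁻¹ with hd
  have hk : k t * (k t ^ 2 - kinv t ^ 2) = k t ^ 3 - kinv t := by
    rw [mul_sub, ← pow_succ', pow_two (kinv t), ← mul_assoc, k_mul_kinv, one_mul]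
  have hfe : ad (U t) (f t) (f t * e t) = d • (f t * kinv t - f t * k t ^ 3) := by
    rw [ad_f_f_mul_e, e_mul_f, ← hd, mul_smul_comm, mul_assoc, hk, mul_sub, ← smul_neg, neg_sub]
  have hef : ad (U t) (f t) (e t * f t) =
      d • (((t : ℝ) : ℂ) ^ (4 : ℤ) • (f t * kinv t) -
        ((t : ℝ) : ℂ) ^ (-4 : ℤ) • (f t * k t ^ 3)) := by
    rw [ad_f_e_mul_f, e_mul_f, ← hd, mul_smul_comm, smul_mul_assoc, hk, sub_mul, kinv_mul_f,
      pow_mul_of_mul_eq_smul k_mul_f, ← zpow_natCast, ← zpow_mul, smul_comm, ← smul_neg, ← smul_neg,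
      neg_sub, smul_sub, smul_smul, smul_smul, ← zpow_add₀ (t_ne t), ← zpow_add₀ (t_ne t)]
    rfl
  refine ⟨d * (1 - ((t : ℝ) : ℂ) ^ (8 : ℤ)), ?_⟩
  rw [ad_f_e_mul_kinv, map_sub, map_smul, hfe, hef, smul_comm _ d, ← smul_sub,
    smul_sub (_ ^ (4 : ℤ)), smul_smul, smul_smul, ← zpow_add₀ (t_ne t), ← zpow_add₀ (t_ne t),
    mul_smul, sub_smul]
  simp

lemma ad_f_pow_three_e_mul_kinv : ad (U t) (f t ^ 3) (e t * kinv t) = 0 := by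
  obtain ⟨c, hc⟩ := ad_f_ad_f_e_mul_kinv (t := t)
  simp only [pow_succ, pow_zero, one_mul, map_mul, Module.End.mul_apply, hc, map_smul,
    ad_f_f_mul_kinv, smul_zero]

lemma e_pow_mul_kinv_pow_succ (l : ℕ) : e t ^ (l + 1) * kinv t ^ (l + 1) =
    ((t : ℝ) : ℂ) ^ (2 * l) • (e t ^ l * kinv t ^ l * (e t * kinv t)) := by
  rw [mul_assoc, ← mul_assoc (kinv t ^ l), pow_mul_of_mul_eq_smul kinv_mul_e, smul_mul_assoc,
    mul_smul_comm, smul_smul, pow_mul, ← mul_pow, ← zpow_natCast _ 2, Nat.cast_ofNat, t_zpow,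
    one_pow, one_smul, mul_assoc, ← pow_succ, ← mul_assoc, ← pow_succ]

lemma isHighestWeightVector_e_pow_mul_kinv_pow (l : ℕ) :
    IsHighestWeightVector (ad (U t)) (2 * l : ℕ) (e t ^ l * kinv t ^ l) := by
  induction l with
  | zero => simpa using isHighestWeightVector_one
  | succ l ih =>
    rw [e_pow_mul_kinv_pow_succ]
    exact_mod_cast ((ih.tmul isHighestWeightVector_e_mul_kinv).map intertwines_mul).smul _

lemma ad_f_pow_e_pow_mul_kinv_pow (l : ℕ) :
    ad (U t) (f t ^ (2 * l + 1)) (e t ^ l * kinv t ^ l) = 0 := by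
  induction l with
  | zero => simp [ad_f_apply, k_mul_f, smul_smul, t_ne t]
  | succ l ih =>
    have hmul := intertwines_mul.apply (f t ^ (2 * (l + 1) + 1))
      ((e t ^ l * kinv t ^ l) ⊗ₜ[ℂ] (e t * kinv t))
    rw [tensorRep_f_pow_tmul_eq_zero (by omega) ih ad_f_pow_three_e_mul_kinv, map_zero,
      LinearMap.mul'_apply] at hmul
    rw [e_pow_mul_kinv_pow_succ, map_smul, ← hmul, smul_zero]

/-! ### The subrepresentations `U^l` -/

/-- The linear map from `V^l` to `U t` sending the weight basis to the elements `λ^l_p`. -/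
def lamMap (t : ℝˣ) (l : ℕ) : V (2 * l) →ₗ[ℂ] U t :=
  hwMap (ad (U t)) (2 * l) (e t ^ l * kinv t ^ l)

lemma lamMap_wt (ht : |(t : ℝ)| ≠ 1) (l : ℕ) (s : Fin (2 * l + 1)) :
    lamMap t l (wt (2 * l) s) = lam t l s := by
  rw [lamMap, hwMap_wt, lam, ← inv_ladderProd_eq_sqrt ht s.is_le, map_pow, Complex.ofReal_inv]

lemma lamMap_wv_zero (t : ℝˣ) (l : ℕ) : lamMap t l (wv (2 * l) 0) = e t ^ l * kinv t ^ l :=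
  hwMap_wv_zero _ _ _

lemma intertwines_lamMap (ht : |(t : ℝ)| ≠ 1) (l : ℕ) :
    Intertwines (irrep t (2 * l)) (ad (U t)) (lamMap t l) :=
  (isHighestWeightVector_e_pow_mul_kinv_pow l).intertwines_hwMap ht (ad_f_pow_e_pow_mul_kinv_pow l)

lemma irrep_e_pow_mul_kinv_pow_wv (t : ℝˣ) {N l : ℕ} (h : l ≤ N) :
    irrep t N (e t ^ l * kinv t ^ l) (wv N l) =
      (((t : ℝ) ^ (l * (2 * l - N : ℤ)) * ladderProd t N l : ℝ) : ℂ) • wv N 0 := by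
  have hkinv : (irrep t N (kinv t)).HasEigenvector (((t : ℝ) : ℂ) ^ (-((N : ℤ) - 2 * l)))
      (wv N l) :=
    ⟨Module.End.mem_eigenspace_iff.2 (map_kinv_of_map_k (irrep_k_wv t N l)), wv_ne_zero h⟩
  rw [map_mul, map_pow _ (kinv t), Module.End.mul_apply, hkinv.pow_apply, map_smul,
    irrep_e_pow_wv, smul_smul, ← zpow_natCast, ← zpow_mul]
  push_cast
  ring_nf

lemma e_pow_mul_kinv_pow_ne_zero (ht : |(t : ℝ)| ≠ 1) (l : ℕ) : e t ^ l * kinv t ^ l ≠ 0 := by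
  intro h
  have hact := irrep_e_pow_mul_kinv_pow_wv t (le_refl l)
  rw [h, map_zero, LinearMap.zero_apply, eq_comm, smul_eq_zero, Complex.ofReal_eq_zero] at hact
  exact hact.elim (mul_ne_zero (zpow_ne_zero _ t.ne_zero) (ladderProd_pos ht le_rfl).ne')
    (wv_ne_zero l.zero_le)

lemma lamMap_ne_zero (ht : |(t : ℝ)| ≠ 1) (l : ℕ) : lamMap t l ≠ 0 := fun h =>
  e_pow_mul_kinv_pow_ne_zero ht l (by rw [← lamMap_wv_zero, h, LinearMap.zero_apply])

lemma lamMap_comp_basisFun (ht : |(t : ℝ)| ≠ 1) (l : ℕ) :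
    lamMap t l ∘ Pi.basisFun ℂ (Fin (2 * l + 1)) = lam t l := by
  ext s
  rw [← lamMap_wt ht, Function.comp_apply, Pi.basisFun_apply, wt]

lemma linearIndependent_lam (ht : |(t : ℝ)| ≠ 1) (l : ℕ) : LinearIndependent ℂ (lam t l) := by
  rw [← lamMap_comp_basisFun ht]
  exact (Pi.basisFun ℂ (Fin (2 * l + 1))).linearIndependent.map' _
    ((intertwines_lamMap ht l).ker_eq_bot (isIrreducibleOn_irrep ht _) (lamMap_ne_zero ht l))

lemma range_lamMap (ht : |(t : ℝ)| ≠ 1) (l : ℕ) : LinearMap.range (lamMap t l) = Ul t l := by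
  rw [Ul, ← lamMap_comp_basisFun ht, Set.range_comp, Submodule.span_image, Module.Basis.span_eq,
    Submodule.map_top]

lemma isIrreducibleOn_Ul (ht : |(t : ℝ)| ≠ 1) (l : ℕ) : IsIrreducibleOn (ad (U t)) (Ul t l) := by
  rw [← range_lamMap ht]
  exact (intertwines_lamMap ht l).isIrreducibleOn_range (isIrreducibleOn_irrep ht _)
    (lamMap_ne_zero ht l)

lemma isIrreducibleTensorOperator_irrep (ht : |(t : ℝ)| ≠ 1) (l N : ℕ) :
    IsIrreducibleTensorOperator (ad (U t)) (Ul t l) (irrep t N) (irrep t N)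
      ((irrep t N).toLinearMap.domRestrict (Ul t l)) where
  irreducible_type := isIrreducibleOn_Ul ht l
  irreducible_source := isIrreducibleOn_irrep ht N
  irreducible_target := isIrreducibleOn_irrep ht N
  equivariant a x y h := by
    simp only [LinearMap.domRestrict_apply, AlgHom.toLinearMap_apply]
    rw [h, map_ad]

/-- The linear map `λ ⊗ x ↦ π^j(λ) x` from `V^l ⊗ V^j` to `V^j`, with `N = 2j`. -/
def lamAct (t : ℝˣ) (l N : ℕ) : V (2 * l) ⊗[ℂ] V N →ₗ[ℂ] V N :=
  TensorProduct.lift (irrep t N).toLinearMap ∘ₗ (lamMap t l).rTensor (V N)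

lemma lamAct_tmul (t : ℝˣ) {l N : ℕ} (x : V (2 * l)) (y : V N) :
    lamAct t l N (x ⊗ₜ y) = irrep t N (lamMap t l x) y := rfl

lemma intertwines_lamAct (ht : |(t : ℝ)| ≠ 1) (l N : ℕ) :
    Intertwines (tensorRep (irrep t (2 * l)) (irrep t N)) (irrep t N) (lamAct t l N) :=
  (intertwines_action (irrep t N)).comp ((intertwines_lamMap ht l).rTensor (irrep t N))

lemma lamAct_wt_tmul_wt (ht : |(t : ℝ)| ≠ 1) {l N : ℕ} (p : Fin (2 * l + 1)) (m n : Fin (N + 1)) :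
    lamAct t l N (wt (2 * l) p ⊗ₜ wt N n) m = matEl t N (lam t l p) m n := by
  rw [lamAct_tmul, lamMap_wt ht, matEl]

end QuantumSU2

namespace QuantumSU2

open HopfRep

/-! ### Transposes -/

section Transpose

variable {R X Y X' Y' ι κ ι' κ' : Type*} [CommRing R] [AddCommGroup X] [Module R X]
  [AddCommGroup Y] [Module R Y] [AddCommGroup X'] [Module R X'] [AddCommGroup Y'] [Module R Y']
  [Fintype ι] [DecidableEq ι] [Fintype κ] [DecidableEq κ]
  [Fintype ι'] [DecidableEq ι'] [Fintype κ'] [DecidableEq κ']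

/-- The transpose of a linear map with respect to fixed bases. -/
def transposeMap (b : Module.Basis ι R X) (c : Module.Basis κ R Y) (T : X →ₗ[R] Y) : Y →ₗ[R] X :=
  Matrix.toLin c b (LinearMap.toMatrix b c T).transpose

lemma toMatrix_transposeMap (b : Module.Basis ι R X) (c : Module.Basis κ R Y) (T : X →ₗ[R] Y) :
    LinearMap.toMatrix c b (transposeMap b c T) = (LinearMap.toMatrix b c T).transpose :=
  LinearMap.toMatrix_toLin _ _ _

lemma transposeMap_add (b : Module.Basis ι R X) (c : Module.Basis κ R Y) (T T' : X →ₗ[R] Y) :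
    transposeMap b c (T + T') = transposeMap b c T + transposeMap b c T' := by
  simp [transposeMap]

lemma transposeMap_map (b : Module.Basis ι R X) (b' : Module.Basis ι' R X')
    (c : Module.Basis κ R Y) (c' : Module.Basis κ' R Y') (T : X →ₗ[R] Y) (T' : X' →ₗ[R] Y') :
    transposeMap (b.tensorProduct b') (c.tensorProduct c') (TensorProduct.map T T') =
      TensorProduct.map (transposeMap b c T) (transposeMap b' c' T') := by
  apply (LinearMap.toMatrix (c.tensorProduct c') (b.tensorProduct b')).injective
  simp only [toMatrix_transposeMap, TensorProduct.toMatrix_map, Matrix.kroneckerMap_transpose]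

lemma transposeMap_comp_transposeMap {b : Module.Basis ι R X} {c : Module.Basis κ R Y}
    {T : X →ₗ[R] Y} {A : X →ₗ[R] X} {B : Y →ₗ[R] Y} (h : T ∘ₗ A = B ∘ₗ T) :
    transposeMap b c T ∘ₗ transposeMap c c B = transposeMap b b A ∘ₗ transposeMap b c T := by
  apply (LinearMap.toMatrix c b).injective
  rw [LinearMap.toMatrix_comp c c b, LinearMap.toMatrix_comp c b b]
  simp only [toMatrix_transposeMap]
  rw [← Matrix.transpose_mul, ← Matrix.transpose_mul, ← LinearMap.toMatrix_comp b b c, h,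
    LinearMap.toMatrix_comp b c c]

lemma sum_repr_mul_repr (b : Module.Basis ι R X) (c : Module.Basis κ R Y) (T : X →ₗ[R] Y)
    (m m' : κ) : ∑ x, c.repr (T (b x)) m * c.repr (T (b x)) m' =
      c.repr ((T ∘ₗ transposeMap b c T) (c m')) m := by
  rw [← LinearMap.toMatrix_apply c c, LinearMap.toMatrix_comp c b c, toMatrix_transposeMap,
    Matrix.mul_apply]
  simp only [Matrix.transpose_apply, LinearMap.toMatrix_apply]

end Transpose

variable {t : ℝˣ} {K L J d p n : ℕ} {T : V K ⊗[ℂ] V L →ₗ[ℂ] V J}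

/-- The weight basis `wt N`, used for taking transposes. -/
abbrev wtBasis (N : ℕ) : Module.Basis (Fin (N + 1)) ℂ (V N) := Pi.basisFun ℂ (Fin (N + 1))

lemma transposeMap_toLinAlgEquiv' {N : ℕ} (M : Matrix (Fin (N + 1)) (Fin (N + 1)) ℂ) :
    transposeMap (wtBasis N) (wtBasis N) (Matrix.toLinAlgEquiv' M) =
      Matrix.toLinAlgEquiv' M.transpose := by
  change transposeMap _ _ (Matrix.toLin' M) = Matrix.toLin' _
  rw [transposeMap, LinearMap.toMatrix_eq_toMatrix', LinearMap.toMatrix'_toLin',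
    Matrix.toLin_eq_toLin']

lemma eMat_transpose (t : ℝˣ) (N : ℕ) : (eMat t N).transpose = fMat t N := by
  ext a b
  simp [eMat_apply, fMat, ladder, eq_comm]

lemma transposeMap_irrep_e (t : ℝˣ) (N : ℕ) :
    transposeMap (wtBasis N) (wtBasis N) (irrep t N (e t)) = irrep t N (f t) := by
  simp [irrep, transposeMap_toLinAlgEquiv', eMat_transpose]

lemma transposeMap_irrep_f (t : ℝˣ) (N : ℕ) :
    transposeMap (wtBasis N) (wtBasis N) (irrep t N (f t)) = irrep t N (e t) := by
  simp [irrep, transposeMap_toLinAlgEquiv', ← eMat_transpose]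

lemma transposeMap_irrep_k (t : ℝˣ) (N : ℕ) :
    transposeMap (wtBasis N) (wtBasis N) (irrep t N (k t)) = irrep t N (k t) := by
  simp [irrep, transposeMap_toLinAlgEquiv', kMat]

lemma transposeMap_irrep_kinv (t : ℝˣ) (N : ℕ) :
    transposeMap (wtBasis N) (wtBasis N) (irrep t N (kinv t)) = irrep t N (kinv t) := by
  simp [irrep, transposeMap_toLinAlgEquiv', kMat]

lemma intertwines_transposeMap
    (hT : Intertwines (tensorRep (irrep t K) (irrep t L)) (irrep t J) T) :
    Intertwines (irrep t J) (tensorRep (irrep t K) (irrep t L))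
      (transposeMap ((wtBasis K).tensorProduct (wtBasis L)) (wtBasis J) T) := by
  have h (a : U t) := transposeMap_comp_transposeMap (b := (wtBasis K).tensorProduct (wtBasis L))
    (c := wtBasis J) (hT a)
  refine intertwines_of_generators ?_ ?_ ?_
  · simpa only [tensorRep_f, tensorRep_e, transposeMap_add, transposeMap_map, transposeMap_irrep_f,
      transposeMap_irrep_k, transposeMap_irrep_kinv] using h (f t)
  · simpa only [tensorRep_f, tensorRep_e, transposeMap_add, transposeMap_map, transposeMap_irrep_e,
      transposeMap_irrep_k, transposeMap_irrep_kinv] using h (e t)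
  · simpa only [tensorRep_k, transposeMap_map, transposeMap_irrep_k] using h (k t)

/-- By Schur's lemma, `T` composed with its transpose is a scalar. -/
lemma sum_apply_mul_apply_eq_ite (ht : |(t : ℝ)| ≠ 1)
    (hT : Intertwines (tensorRep (irrep t K) (irrep t L)) (irrep t J) T) (m m' : Fin (J + 1)) :
    ∑ p, ∑ n, T (wt K p ⊗ₜ wt L n) m * T (wt K p ⊗ₜ wt L n) m' =
      if m = m' then ∑ p, ∑ n, T (wt K p ⊗ₜ wt L n) 0 ^ 2 else 0 := by
  have hgram (m m') := sum_repr_mul_repr ((wtBasis K).tensorProduct (wtBasis L)) (wtBasis J) T m m'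
  obtain ⟨c, hc⟩ := (hT.comp (intertwines_transposeMap hT)).exists_eq_smul_id
    (isIrreducibleOn_irrep ht J)
  simp only [hc, Fintype.sum_prod_type, Module.Basis.tensorProduct_apply', Pi.basisFun_apply,
    Pi.basisFun_repr, LinearMap.smul_apply, LinearMap.id_apply, Pi.smul_apply, Pi.single_apply,
    smul_eq_mul, mul_ite, mul_one, mul_zero] at hgram
  simp only [pow_two, wt, hgram, if_true]

/-! ### Matrix elements of intertwiners in the highest weight row -/

lemma apply_tmul_zero_of_add_ne (ht : |(t : ℝ)| ≠ 1)
    (hT : Intertwines (tensorRep (irrep t K) (irrep t L)) (irrep t J) T) (hd : K + L = J + 2 * d)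
    (h : p + n ≠ d) : T (wv K p ⊗ₜ wv L n) 0 = 0 := by
  have hk := congrFun (hT.apply (k t) (wv K p ⊗ₜ wv L n)) 0
  rw [tensorRep_k, TensorProduct.map_tmul, irrep_k_wv, irrep_k_wv, TensorProduct.smul_tmul_smul,
    map_smul, Pi.smul_apply, smul_eq_mul, irrep_k_apply_apply, ← zpow_add₀ (t_ne t)] at hk
  by_contra h0
  have hweight := mul_right_cancel₀ h0 hk
  rw [← Complex.ofReal_zpow, ← Complex.ofReal_zpow, Complex.ofReal_inj] at hweight
  have hexp := zpow_injective ht hweight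
  rw [Fin.val_zero] at hexp
  omega

lemma apply_tmul_zero_ladder
    (hT : Intertwines (tensorRep (irrep t K) (irrep t L)) (irrep t J) T) (p n : ℕ) :
    ladder t K p * ((t : ℝ) : ℂ) ^ (-((L : ℤ) - 2 * n)) * T (wv K (p + 1) ⊗ₜ wv L n) 0 +
      ((t : ℝ) : ℂ) ^ ((K : ℤ) - 2 * p) * ladder t L n * T (wv K p ⊗ₜ wv L (n + 1)) 0 = 0 := by
  have hf := congrFun (hT.apply (f t) (wv K p ⊗ₜ wv L n)) 0
  rw [irrep_f_apply_zero, tensorRep_f, LinearMap.add_apply, TensorProduct.map_tmul,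
    TensorProduct.map_tmul, irrep_f_wv, irrep_f_wv, irrep_k_wv,
    map_kinv_of_map_k (irrep_k_wv t L n), TensorProduct.smul_tmul_smul,
    TensorProduct.smul_tmul_smul] at hf
  simpa using hf

/-- Surjectivity of a nonzero intertwiner onto the irreducible `V J` reduces the claim to the
highest weight row, which the ladder relation determines from one entry. -/
lemma eq_zero_of_apply_tmul_zero_eq_zero (ht : |(t : ℝ)| ≠ 1)
    (hT : Intertwines (tensorRep (irrep t K) (irrep t L)) (irrep t J) T) (hd : K + L = J + 2 * d)
    (h0 : T (wv K 0 ⊗ₜ wv L d) 0 = 0) : T = 0 := by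
  have hrow : ∀ p ≤ K, ∀ n ≤ L, T (wv K p ⊗ₜ wv L n) 0 = 0 := by
    intro p
    induction p with
    | zero =>
      intro _ n _
      rcases eq_or_ne n d with rfl | hn
      · exact h0
      · exact apply_tmul_zero_of_add_ne ht hT hd (by omega)
    | succ p ih =>
      intro hp n hn
      have hvanish : T (wv K p ⊗ₜ wv L (n + 1)) 0 = 0 := by
        rcases hn.lt_or_eq with hn | rfl
        · exact ih (by omega) (n + 1) hn
        · simp [wv_of_lt]
      have hl := apply_tmul_zero_ladder hT p n
      rw [hvanish, mul_zero, add_zero] at hl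
      refine (mul_eq_zero.1 hl).resolve_left (mul_ne_zero ?_ (zpow_ne_zero _ (t_ne t)))
      exact_mod_cast (ladder_pos ht hp).ne'
  have hproj : (LinearMap.proj (0 : Fin (J + 1)) : V J →ₗ[ℂ] ℂ) ∘ₗ T = 0 :=
    TensorProduct.ext (linearMap_ext_wv fun p hp => linearMap_ext_wv fun n hn => hrow p hp n hn)
  by_contra hne
  obtain ⟨x, hx⟩ := LinearMap.range_eq_top.1 (hT.range_eq_top (isIrreducibleOn_irrep ht J) hne)
    (wv J 0)
  simpa [hx, wv] using LinearMap.congr_fun hproj x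

lemma ladder_sq_mul_apply_tmul_zero_sq
    (hT : Intertwines (tensorRep (irrep t K) (irrep t L)) (irrep t J) T)
    (hd : K + L = J + 2 * d) (h : p + n + 1 = d) :
    (ladder t K p : ℂ) ^ 2 * T (wv K (p + 1) ⊗ₜ wv L n) 0 ^ 2 =
      ((t : ℝ) : ℂ) ^ (2 * (J + 2)) * (ladder t L n : ℂ) ^ 2 *
        T (wv K p ⊗ₜ wv L (n + 1)) 0 ^ 2 := by
  have hne : ((t : ℝ) : ℂ) ^ (-((L : ℤ) - 2 * n)) ≠ 0 := zpow_ne_zero _ (t_ne t)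
  have hexp : ((t : ℝ) : ℂ) ^ (2 * (J + 2)) * (((t : ℝ) : ℂ) ^ (-((L : ℤ) - 2 * n))) ^ 2 =
      (((t : ℝ) : ℂ) ^ ((K : ℤ) - 2 * p)) ^ 2 := by
    simp only [← zpow_natCast, ← zpow_mul, ← zpow_add₀ (t_ne t)]
    congr 1
    push_cast
    omega
  have hl := apply_tmul_zero_ladder hT p n
  refine mul_right_cancel₀ (pow_ne_zero 2 hne) ?_
  linear_combination (ladder t K p * ((t : ℝ) : ℂ) ^ (-((L : ℤ) - 2 * n)) *
      T (wv K (p + 1) ⊗ₜ wv L n) 0 -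
    ((t : ℝ) : ℂ) ^ ((K : ℤ) - 2 * p) * ladder t L n * T (wv K p ⊗ₜ wv L (n + 1)) 0) * hl -
    (ladder t L n : ℂ) ^ 2 * T (wv K p ⊗ₜ wv L (n + 1)) 0 ^ 2 * hexp

lemma ladder_sq_mul_qmultichoose (ht : |(t : ℝ)| ≠ 1) (hK : d ≤ K) (hL : d ≤ L)
    (h : p + n + 1 = d) :
    ladder t K p ^ 2 * (qmultichoose t (L - d + 1) (p + 1) * qmultichoose t (K - d + 1) n) =
      ladder t L n ^ 2 * (qmultichoose t (L - d + 1) p * qmultichoose t (K - d + 1) (n + 1)) := by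
  have hp := qmultichoose_succ_right_mul ht (L - d + 1) p
  have hn := qmultichoose_succ_right_mul ht (K - d + 1) n
  rw [show ((L - d + 1 : ℕ) : ℤ) + p = L - n by omega] at hp
  rw [show ((K - d + 1 : ℕ) : ℤ) + n = K - p by omega] at hn
  rw [ladder_sq (by omega), ladder_sq (by omega)]
  linear_combination qnum t (K - p) * qmultichoose t (K - d + 1) n * hp -
    qnum t (L - n) * qmultichoose t (L - d + 1) p * hn

lemma apply_tmul_zero_sq (ht : |(t : ℝ)| ≠ 1)
    (hT : Intertwines (tensorRep (irrep t K) (irrep t L)) (irrep t J) T)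
    (hd : K + L = J + 2 * d) (hK : d ≤ K) (hL : d ≤ L) (h : p + n = d) :
    T (wv K p ⊗ₜ wv L n) 0 ^ 2 * (qmultichoose t (K - d + 1) d : ℂ) =
      T (wv K 0 ⊗ₜ wv L d) 0 ^ 2 * ((t ^ (2 * (J + 2) * p) *
        (qmultichoose t (L - d + 1) p * qmultichoose t (K - d + 1) n) : ℝ) : ℂ) := by
  induction p generalizing n with
  | zero =>
    obtain rfl : n = d := by omega
    simp
  | succ p ih =>
    have hprev := ih (n := n + 1) (by omega)
    have hstep := ladder_sq_mul_apply_tmul_zero_sq hT hd (p := p) (n := n) (by omega)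
    have hq := congrArg Complex.ofReal
      (ladder_sq_mul_qmultichoose (t := t) (p := p) (n := n) ht hK hL (by omega))
    have hne : (ladder t K p : ℂ) ^ 2 ≠ 0 := by
      exact_mod_cast (pow_pos (ladder_pos ht (show p < K by omega)) 2).ne'
    refine mul_left_cancel₀ hne ?_
    push_cast at hprev hq ⊢
    linear_combination (qmultichoose t (K - d + 1) d : ℂ) * hstep +
      ((t : ℝ) : ℂ) ^ (2 * (J + 2)) * (ladder t L n : ℂ) ^ 2 * hprev -
      T (wv K 0 ⊗ₜ wv L d) 0 ^ 2 * ((t : ℝ) : ℂ) ^ (2 * (J + 2) * (p + 1)) * hq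

lemma sum_fin_eq_sum_antidiagonal {M : Type*} [AddCommMonoid M] {g : ℕ → ℕ → M} (hK : d ≤ K)
    (hL : d ≤ L) (hg : ∀ p n, p + n ≠ d → g p n = 0) :
    ∑ p : Fin (K + 1), ∑ n : Fin (L + 1), g p n =
      ∑ x ∈ Finset.HasAntidiagonal.antidiagonal d, g x.1 x.2 := by
  calc ∑ p : Fin (K + 1), ∑ n : Fin (L + 1), g p n
      = ∑ x ∈ Finset.range (K + 1) ×ˢ Finset.range (L + 1), g x.1 x.2 := by
        rw [Finset.sum_product, Finset.sum_range]
        simp only [Finset.sum_range]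
    _ = ∑ x ∈ Finset.HasAntidiagonal.antidiagonal d, g x.1 x.2 := by
        refine (Finset.sum_subset (fun x hx => ?_) fun x _ hx => hg _ _ ?_).symm
        · have := Finset.HasAntidiagonal.mem_antidiagonal.1 hx
          simp only [Finset.mem_product, Finset.mem_range]
          omega
        · rwa [Finset.HasAntidiagonal.mem_antidiagonal] at hx

lemma sum_apply_zero_sq (ht : |(t : ℝ)| ≠ 1)
    (hT : Intertwines (tensorRep (irrep t K) (irrep t L)) (irrep t J) T)
    (hd : K + L = J + 2 * d) (hK : d ≤ K) (hL : d ≤ L) :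
    (∑ p, ∑ n, T (wt K p ⊗ₜ wt L n) 0 ^ 2) * (qmultichoose t (K - d + 1) d : ℂ) =
      T (wv K 0 ⊗ₜ wv L d) 0 ^ 2 *
        ((t ^ (2 * (L - d + 1) * d) * qmultichoose t (J + 2) d : ℝ) : ℂ) := by
  have hvandermonde := qmultichoose_vandermonde ht (L - d + 1) (K - d + 1) d
  rw [show L - d + 1 + (K - d + 1) = J + 2 by omega] at hvandermonde
  simp only [wt_eq_wv]
  rw [sum_fin_eq_sum_antidiagonal (g := fun p n => T (wv K p ⊗ₜ wv L n) 0 ^ 2) hK hL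
    fun p n h => by rw [apply_tmul_zero_of_add_ne ht hT hd h, zero_pow two_ne_zero],
    Finset.sum_mul, ← hvandermonde, Complex.ofReal_sum, Finset.mul_sum]
  exact Finset.sum_congr rfl fun x hx =>
    apply_tmul_zero_sq ht hT hd hK hL (Finset.HasAntidiagonal.mem_antidiagonal.1 hx)

end QuantumSU2

namespace QuantumSU2

open HopfRep

/-! ### Clebsch–Gordan coefficients as matrix elements of intertwiners -/

variable {t : ℝˣ} {K L J d : ℕ}

namespace IsClebschGordan

variable {C C' : Fin (K + 1) → Fin (L + 1) → Fin (J + 1) → ℝ}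

lemma exists_intertwines (hC : IsClebschGordan t K L J C) : ∃ T : V K ⊗[ℂ] V L →ₗ[ℂ] V J,
    Intertwines (tensorRep (irrep t K) (irrep t L)) (irrep t J) T ∧
      ∀ p n m, T (wt K p ⊗ₜ wt L n) m = C p n m := by
  obtain ⟨T, hTC, hT⟩ := hC.exists_hom
  exact ⟨T, hT, fun p n m => by
    rw [hTC]
    simp [wt, Pi.single_apply]⟩

lemma le_right (ht : |(t : ℝ)| ≠ 1) (hd : K + L = J + 2 * d) (hC : IsClebschGordan t K L J C) :
    d ≤ L := by
  by_contra h
  obtain ⟨T, hT, hTC⟩ := hC.exists_intertwines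
  have hzero : T = 0 := eq_zero_of_apply_tmul_zero_eq_zero ht hT hd (by
    rw [wv_of_lt (not_le.1 h), TensorProduct.tmul_zero, map_zero, Pi.zero_apply])
  have hCzero (p n m) : C p n m = 0 := by
    rw [← Complex.ofReal_eq_zero, ← hTC, hzero, LinearMap.zero_apply, Pi.zero_apply]
  simpa [hCzero] using hC.orthonormal 0 0

lemma mul_eq_mul (ht : |(t : ℝ)| ≠ 1) {n : Fin (L + 1)} (hn : K + L = J + 2 * n)
    (hC : IsClebschGordan t K L J C) (hC' : IsClebschGordan t K L J C') (p : Fin (K + 1))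
    (q : Fin (L + 1)) (m : Fin (J + 1)) : C' 0 n 0 * C p q m = C 0 n 0 * C' p q m := by
  obtain ⟨T, hT, hTC⟩ := hC.exists_intertwines
  obtain ⟨T', hT', hTC'⟩ := hC'.exists_intertwines
  have happly (p q m) : ((C' 0 n 0 : ℂ) • T - (C 0 n 0 : ℂ) • T') (wt K p ⊗ₜ wt L q) m =
      ((C' 0 n 0 * C p q m - C 0 n 0 * C' p q m : ℝ) : ℂ) := by
    simp [hTC, hTC']
  have hzero : (C' 0 n 0 : ℂ) • T - (C 0 n 0 : ℂ) • T' = 0 :=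
    eq_zero_of_apply_tmul_zero_eq_zero ht ((hT.smul _).sub (hT'.smul _)) hn (by
      have htop := happly 0 n 0
      rwa [mul_comm, sub_self, Complex.ofReal_zero, wt_eq_wv, wt_eq_wv] at htop)
  rw [← sub_eq_zero, ← Complex.ofReal_eq_zero, ← happly, hzero, LinearMap.zero_apply, Pi.zero_apply]

lemma sum_mul_sq (hC : IsClebschGordan t K L J C) (x : ℝ) :
    ∑ p, ∑ n, (x * C p n 0) ^ 2 = x ^ 2 := by
  have hnorm := hC.orthonormal 0 0
  simp only [mul_pow, ← Finset.mul_sum, pow_two (C _ _ _), hnorm, if_true, mul_one]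

lemma unique (ht : |(t : ℝ)| ≠ 1) (hd : K + L = J + 2 * d) (hC : IsClebschGordan t K L J C)
    (hC' : IsClebschGordan t K L J C') : C = C' := by
  obtain ⟨n, rfl⟩ : ∃ n : Fin (L + 1), (n : ℕ) = d :=
    ⟨⟨d, Nat.lt_succ_of_le (hC.le_right ht hd)⟩, rfl⟩
  have hprop := hC.mul_eq_mul ht hd hC'
  have hpos := hC.phase n hd
  have hpos' := hC'.phase n hd
  have hsq : C' 0 n 0 ^ 2 = C 0 n 0 ^ 2 := by
    rw [← hC.sum_mul_sq, ← hC'.sum_mul_sq]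
    simp only [hprop]
  have htop : C' 0 n 0 = C 0 n 0 := by
    refine (eq_or_eq_neg_of_sq_eq_sq _ _ hsq).resolve_right fun h => ?_
    rw [h, mul_neg] at hpos'
    linarith
  ext p q m
  refine mul_left_cancel₀ (right_ne_zero_of_mul hpos.ne') ?_
  rw [← hprop, htop]

lemma cg_eq (ht : |(t : ℝ)| ≠ 1) (hd : K + L = J + 2 * d) (hC : IsClebschGordan t K L J C) :
    cg t K L J = C := by
  have hex : ∃ C, IsClebschGordan t K L J C := ⟨C, hC⟩
  rw [cg, dif_pos hex]
  exact hex.choose_spec.unique ht hd hC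

end IsClebschGordan

lemma cg_eq_zero_of_lt (ht : |(t : ℝ)| ≠ 1) (hd : K + L = J + 2 * d) (h : L < d) :
    cg t K L J = 0 :=
  dif_neg fun ⟨_, hC⟩ => h.not_ge (hC.le_right ht hd)

variable {T : V K ⊗[ℂ] V L →ₗ[ℂ] V J} {R : Fin (K + 1) → Fin (L + 1) → Fin (J + 1) → ℝ} {α : ℝ}

lemma isClebschGordan_div (ht : |(t : ℝ)| ≠ 1)
    (hT : Intertwines (tensorRep (irrep t K) (irrep t L)) (irrep t J) T)
    (hR : ∀ p n m, T (wt K p ⊗ₜ wt L n) m = R p n m) (hα : 0 < α)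
    (hnorm : ∑ p, ∑ n, R p n 0 ^ 2 = α ^ 2)
    (hphase : ∀ n : Fin (L + 1), K + L = J + 2 * n →
      0 < (t : ℝ) ^ ((n : ℕ) * (L + 1 - n)) * R 0 n 0) :
    IsClebschGordan t K L J fun p n m => R p n m / α where
  exists_hom := by
    refine ⟨((α⁻¹ : ℝ) : ℂ) • T, fun p n => ?_, hT.smul _⟩
    ext m
    rw [LinearMap.smul_apply, Pi.smul_apply, hR, smul_eq_mul, ← Complex.ofReal_mul, inv_mul_eq_div]
    simp [wt, Pi.single_apply]
  orthonormal m m' := by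
    have horth := sum_apply_mul_apply_eq_ite ht hT m m'
    simp only [hR] at horth
    have hreal : ∑ p, ∑ n, R p n m * R p n m' = if m = m' then α ^ 2 else 0 := by
      rw [← hnorm]
      split_ifs at horth ⊢ <;> exact_mod_cast horth
    simp only [div_mul_div_comm, ← Finset.sum_div, hreal, ← pow_two, ite_div, zero_div,
      div_self (pow_pos hα 2).ne']
  phase n hn := by
    rw [← mul_div_assoc]
    exact div_pos (hphase n hn) hα

end QuantumSU2

namespace QuantumSU2

open HopfRep

/-! ### Reality of the matrix elements -/

variable {t : ℝˣ} {l N : ℕ}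

/-- The elements of `U_t` with real matrix elements in the weight basis of `V^j`, with `N = 2j`. -/
def realElements (t : ℝˣ) (N : ℕ) : Subring (U t) :=
  (Complex.ofRealHom.mapMatrix (m := Fin (N + 1))).range.comap
    (LinearMap.toMatrixAlgEquiv'.toAlgHom.comp (irrep t N) :
      U t →ₐ[ℂ] Matrix (Fin (N + 1)) (Fin (N + 1)) ℂ).toRingHom

lemma mem_realElements {a : U t} :
    a ∈ realElements t N ↔ ∃ R : Matrix (Fin (N + 1)) (Fin (N + 1)) ℝ,
      ∀ m n, matEl t N a m n = R m n := by
  refine exists_congr fun R => ⟨fun h m n => ?_, fun h => ?_⟩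
  · simpa [matEl, wt] using (congrFun₂ h m n).symm
  · ext m n
    simpa [matEl, wt] using (h m n).symm

lemma smul_mem_realElements {a : U t} (c : ℝ) (ha : a ∈ realElements t N) :
    (c : ℂ) • a ∈ realElements t N := by
  obtain ⟨R, hR⟩ := mem_realElements.1 ha
  refine mem_realElements.2 ⟨c • R, fun m n => ?_⟩
  have h := hR m n
  simp only [matEl, map_smul, LinearMap.smul_apply, Pi.smul_apply, smul_eq_mul, Matrix.smul_apply,
    Complex.ofReal_mul] at h ⊢
  rw [h]

lemma mem_realElements_of_wv {a : U t}
    (h : ∀ n ≤ N, ∃ (c : ℝ) (s : ℕ), irrep t N a (wv N n) = (c : ℂ) • wv N s) :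
    a ∈ realElements t N := by
  choose c s h using fun n : Fin (N + 1) => h n n.is_le
  refine mem_realElements.2 ⟨fun m n => if (m : ℕ) = s n then c n else 0, fun m n => ?_⟩
  simp [matEl, wt_eq_wv, h, wv, apply_ite Complex.ofReal]

lemma e_mem_realElements (t : ℝˣ) (N : ℕ) : e t ∈ realElements t N :=
  mem_realElements_of_wv fun n _ => match n with
    | 0 => ⟨0, 0, by simp [irrep_e_wv_zero]⟩
    | n + 1 => ⟨_, _, irrep_e_wv_succ t N n⟩

lemma f_mem_realElements (t : ℝˣ) (N : ℕ) : f t ∈ realElements t N :=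
  mem_realElements_of_wv fun n _ => ⟨_, _, irrep_f_wv t N n⟩

lemma k_mem_realElements (t : ℝˣ) (N : ℕ) : k t ∈ realElements t N :=
  mem_realElements_of_wv fun n _ => ⟨_, n, by rw [irrep_k_wv, ← Complex.ofReal_zpow]⟩

lemma kinv_mem_realElements (t : ℝˣ) (N : ℕ) : kinv t ∈ realElements t N :=
  mem_realElements_of_wv fun n _ =>
    ⟨_, n, by rw [map_kinv_of_map_k (irrep_k_wv t N n), ← Complex.ofReal_zpow]⟩

lemma lam_mem_realElements (t : ℝˣ) (N l : ℕ) (s : Fin (2 * l + 1)) :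
    lam t l s ∈ realElements t N := by
  refine smul_mem_realElements _ ?_
  induction (s : ℕ) with
  | zero =>
    exact mul_mem (pow_mem (e_mem_realElements t N) l) (pow_mem (kinv_mem_realElements t N) l)
  | succ s ih =>
    have hf := f_mem_realElements t N
    have hk := k_mem_realElements t N
    rw [pow_succ', Module.End.mul_apply, ad_f_apply, ← Complex.ofReal_zpow]
    exact sub_mem (mul_mem (mul_mem hf ih) hk)
      (smul_mem_realElements _ (mul_mem (mul_mem hk ih) hf))

/-! ### The reduced matrix element -/

lemma reducedMatrixElement_pos (ht : |(t : ℝ)| ≠ 1) (l N : ℕ) : 0 < reducedMatrixElement t l N := by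
  have ht_pow : 0 < (t : ℝ) ^ (l * (l + 1)) := (Nat.even_mul_succ_self l).pow_pos t.ne_zero
  have hl := qfact_pos ht l
  have hNl := qfact_pos ht (N + l + 1)
  have h2l := qfact_pos ht (2 * l)
  have hN_sub := qfact_pos ht (N - l)
  have hN : 0 < qnum t (N + 1) := qnum_pos ht (by omega)
  rw [reducedMatrixElement]
  positivity

lemma reducedMatrixElement_sq (ht : |(t : ℝ)| ≠ 1) (hl : l ≤ N) :
    reducedMatrixElement t l N ^ 2 * qmultichoose t (l + 1) l =
      ((t : ℝ) ^ (l * (2 * l - N : ℤ)) * ladderProd t N l) ^ 2 *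
        ((t : ℝ) ^ (2 * (N - l + 1) * l) * qmultichoose t (N + 2) l) := by
  have hl_pos := qfact_pos ht l
  have hNl := qfact_pos ht (N + l + 1)
  have h2l := qfact_pos ht (2 * l)
  have hN_sub := qfact_pos ht (N - l)
  have hN_succ : 0 < qnum t (N + 1) := qnum_pos ht (by omega)
  have hN := qfact_pos ht N
  have hexp : ((t : ℝ) ^ (l * (l + 1))) ^ 2 =
      ((t : ℝ) ^ (l * (2 * l - N : ℤ))) ^ 2 * (t : ℝ) ^ (2 * (N - l + 1) * l) := by
    simp only [← zpow_natCast, ← zpow_mul, ← zpow_add₀ t.ne_zero]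
    congr 1
    push_cast [Nat.cast_sub hl]
    ring
  have hladder : ladderProd t N l ^ 2 = qfact t N * qfact t l / qfact t (N - l) := by
    rw [eq_div_iff hN_sub.ne', ladderProd_sq hl]
  rw [reducedMatrixElement, mul_pow, mul_pow, Real.sq_sqrt (by positivity), mul_pow, hladder,
    qmultichoose_succ_left ht, qmultichoose_succ_left ht, qfact_succ t N,
    show N + 1 + l = N + l + 1 by ring, show l + l = 2 * l by ring, hexp]
  field_simp

lemma lamAct_wv_zero_tmul_wv (t : ℝˣ) (hl : l ≤ N) :
    lamAct t l N (wv (2 * l) 0 ⊗ₜ wv N l) 0 =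
      (((t : ℝ) ^ (l * (2 * l - N : ℤ)) * ladderProd t N l : ℝ) : ℂ) := by
  rw [lamAct_tmul, lamMap_wv_zero, irrep_e_pow_mul_kinv_pow_wv t hl]
  simp [wv]

lemma sum_lamAct_sq (ht : |(t : ℝ)| ≠ 1) (hl : l ≤ N) :
    ∑ p, ∑ n, lamAct t l N (wt (2 * l) p ⊗ₜ wt N n) 0 ^ 2 =
      ((reducedMatrixElement t l N ^ 2 : ℝ) : ℂ) := by
  have hsum := sum_apply_zero_sq ht (intertwines_lamAct ht l N) (d := l) (by omega) (by omega) hl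
  rw [lamAct_wv_zero_tmul_wv t hl, ← Complex.ofReal_pow, ← Complex.ofReal_mul,
    show 2 * l - l + 1 = l + 1 by omega, ← reducedMatrixElement_sq ht hl,
    Complex.ofReal_mul] at hsum
  exact mul_right_cancel₀ (Complex.ofReal_ne_zero.2 (qmultichoose_pos ht l l).ne') hsum

lemma pow_mul_zpow_pos (t : ℝˣ) (hl : l ≤ N) :
    0 < (t : ℝ) ^ (l * (N + 1 - l)) * (t : ℝ) ^ (l * (2 * l - N : ℤ)) := by
  have hexp : ((l * (N + 1 - l) : ℕ) : ℤ) + l * (2 * l - N) = l * (l + 1) := by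
    push_cast [Nat.cast_sub (show l ≤ N + 1 by omega)]
    ring
  rw [← zpow_natCast, ← zpow_add₀ t.ne_zero, hexp]
  exact (Int.even_mul_succ_self l).zpow_pos t.ne_zero

lemma isClebschGordan_matEl_lam (ht : |(t : ℝ)| ≠ 1) (hl : l ≤ N)
    {R : Fin (2 * l + 1) → Matrix (Fin (N + 1)) (Fin (N + 1)) ℝ}
    (hR : ∀ p m n, matEl t N (lam t l p) m n = R p m n) :
    IsClebschGordan t (2 * l) N N fun p n m => R p m n / reducedMatrixElement t l N := by
  have hact (p n m) : lamAct t l N (wt (2 * l) p ⊗ₜ wt N n) m = R p m n := by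
    rw [lamAct_wt_tmul_wt ht, hR]
  refine isClebschGordan_div ht (intertwines_lamAct ht l N) hact (reducedMatrixElement_pos ht l N)
    ?_ fun n hn => ?_
  · have hsum := sum_lamAct_sq ht hl
    simp only [hact] at hsum
    exact_mod_cast hsum
  · obtain hnl : (n : ℕ) = l := by omega
    have htop : R 0 0 n = (t : ℝ) ^ (l * (2 * l - N : ℤ)) * ladderProd t N l := by
      rw [← Complex.ofReal_inj, ← hact, wt_eq_wv, wt_eq_wv, hnl, Fin.val_zero,
        lamAct_wv_zero_tmul_wv t hl]
    rw [htop, hnl, ← mul_assoc]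
    exact mul_pos (pow_mul_zpow_pos t hl) (ladderProd_pos ht hl)

lemma matEl_lam_eq (ht : |(t : ℝ)| ≠ 1) (hl : l ≤ N) (p : Fin (2 * l + 1)) (m n : Fin (N + 1)) :
    matEl t N (lam t l p) m n =
      ((reducedMatrixElement t l N * cg t (2 * l) N N p n m : ℝ) : ℂ) := by
  choose R hR using fun p => mem_realElements.1 (lam_mem_realElements t N l p)
  rw [(isClebschGordan_matEl_lam ht hl hR).cg_eq ht (d := l) (by omega), hR,
    mul_div_cancel₀ _ (reducedMatrixElement_pos ht l N).ne']

lemma matEl_lam_eq_zero (ht : |(t : ℝ)| ≠ 1) (h : N < l) (p : Fin (2 * l + 1))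
    (m n : Fin (N + 1)) : matEl t N (lam t l p) m n = 0 := by
  have hzero : lamAct t l N = 0 :=
    eq_zero_of_apply_tmul_zero_eq_zero ht (intertwines_lamAct ht l N) (d := l) (by omega) (by
      rw [wv_of_lt h, TensorProduct.tmul_zero, map_zero, Pi.zero_apply])
  rw [← lamAct_wt_tmul_wt ht, hzero, LinearMap.zero_apply, Pi.zero_apply]

end QuantumSU2

end

theorem proposition4 (t : ℝˣ) (ht : t ≠ 1) (ht' : t ≠ -1) (l N : ℕ) :
    LinearIndependent ℂ (QuantumSU2.lam t l) ∧
    HopfRep.IsIrreducibleTensorOperator (HopfRep.ad (QuantumSU2.U t)) (QuantumSU2.Ul t l)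
      (QuantumSU2.irrep t N) (QuantumSU2.irrep t N)
      ((QuantumSU2.irrep t N).toLinearMap.domRestrict (QuantumSU2.Ul t l)) ∧
    (l ≤ N → ∀ (p : Fin (2 * l + 1)) (m n : Fin (N + 1)),
      QuantumSU2.matEl t N (QuantumSU2.lam t l p) m n =
        ((QuantumSU2.reducedMatrixElement t l N * QuantumSU2.cg t (2 * l) N N p n m : ℝ) : ℂ)) ∧
    (N < l → ∀ (p : Fin (2 * l + 1)) (m n : Fin (N + 1)),
      QuantumSU2.matEl t N (QuantumSU2.lam t l p) m n = 0 ∧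
        QuantumSU2.cg t (2 * l) N N p n m = 0) := by
  open QuantumSU2 in
  have h := abs_coe_ne_one ht ht'
  exact ⟨linearIndependent_lam h l, isIrreducibleTensorOperator_irrep h l N, matEl_lam_eq h,
    fun hl p m n => ⟨matEl_lam_eq_zero h hl p m n, by
      rw [cg_eq_zero_of_lt h (d := l) (by omega) hl, Pi.zero_apply, Pi.zero_apply, Pi.zero_apply]⟩⟩
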